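/- \textbf{Semidefinite program.} For $x\in\mathbb{R}^d$, $r\ge 0$ and $\mathbf{Z}=(Z_1,\dots,Z_k)\in(\mathbb{R}^d)^k$ ($d,k\ge 1$), let $MT(x,r,\mathbf{Z})$ be the problem of maximizing $\sum_{i=1}^k X_{1,b_i}$ over the real symmetric positive semidefinite matrices $X$, with rows and columns indexed by the symbols $1,b_1,\dots,b_k,v_1,\dots,v_d$, that satisfy $X_{1,1}=1$, $X_{1,b_i}=X_{b_i,b_i}$ and $\langle v_{b_i},Z_i-x\rangle\ge r\,X_{b_i,b_i}$ for all $i$, and $\sum_{j=1}^d X_{v_j,v_j}=1$, where $v_{b_i}=(X_{b_i,v_1},\dots,X_{b_i,v_d})$. \textbf{Distance Estimation} $(\mathbf{Z},x)$ returns the largest $r\ge 0$ for which the optimal value of $MT(x,r,\mathbf{Z})$ is at least $0.9k$. \textbf{Gradient Estimation} $(\mathbf{Z},x)$ computes the distance estimate $r$ for $(\mathbf{Z},x)$, an optimal solution $X$ of $MT(x,r,\mathbf{Z})$, and a (unit) top singular vector $g$ of the submatrix $(X_{v_i,v_j})_{i,j}$; it returns $g$ if at least $0.9k$ of the indices $i$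 satisfy $\langle Z_i-x,g\rangle\ge 0$, and $-g$ otherwise. \textbf{Mean Estimation} has as inputs data points $X_1,\dots,X_n\in\mathbb{R}^d$, a target confidence $\delta$, a number of iterations $T$ and a stepsize $\gamma$. It sets $k=\lceil 3200\log(1/\delta)\rceil$, splits the data into $k$ consecutive bins, the $i$-th one consisting of the $X_j$ with $\lfloor (i-1)n/k\rfloor<j\le\lfloor in/k\rfloor$, and lets $Z_i$ be the mean of the $i$-th bin and $\mathbf{Z}=(Z_1,\dots,Z_k)$. Starting from $x^*=x_0=0$ and $d^*=\infty$, for $t=0,1,\dots,T$ it computes the distance estimate $d_t$ and a gradient estimate $g_t$ for $(\mathbf{Z},x_t)$; if $d_t<d^*$, it sets $x^*=x_t$ and $d^*=d_t$; then it sets $x_{t+1}=x_t+\gamma d_t g_t$. Finally it returns $x^*$. \textbf{Theorem.} Let $X_1,\dots,X_n$ be i.i.d. random vectors in $\mathbb{R}^d$ ($d\ge 1$) with finite second moments, mean $\mu$ and covariance matrix $\Sigma$. Let $\varepsilon>0$ and $\delta\in(0,1)$ with $\lceil 3200\log(1/\delta)\rceil\le n$. Run Mean Estimation on $X_1,\dots,X_n$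 with target confidence $\delta$, stepsize $\gamma=1/20$ and $T=\max\bigl(0,\lceil 1000\log(\|\mu\|/\varepsilon)\rceil\bigr)$ iterations ($T=0$ if $\mu=0$). Then the algorithm is well defined on every data set (all the maxima exist), and with probability at least $1-\delta$, whatever optimal solutions and top singular vectors are chosen in its steps, the returned vector $x^*$ satisfies $$\|x^*-\mu\|\le\max\left(\varepsilon,\;480000\left(\sqrt{\frac{\operatorname{Tr}\Sigma}{n}}+\sqrt{\frac{\|\Sigma\|\log(1/\delta)}{n}}\right)\right),$$ where $\|\Sigma\|$ is the spectral norm of $\Sigma$. -/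

import Mathlib

open scoped BigOperators

noncomputable section

namespace SubGaussianMean

/-- `ℝ^d` with the Euclidean norm. -/
abbrev Vec (d : ℕ) : Type := EuclideanSpace ℝ (Fin d)

/-- The spectral norm of a real square matrix (its largest singular value). -/
def specNorm {d : ℕ} (A : Matrix (Fin d) (Fin d) ℝ) : ℝ :=
  ‖Matrix.toEuclideanCLM (n := Fin d) (𝕜 := ℝ) A‖

/-- `g` is a top singular vector of `A`: a unit vector on which `A` attains its largest singular
value. -/
def IsTopSingularVector {d : ℕ} (A : Matrix (Fin d) (Fin d) ℝ) (g : Vec d) : Prop :=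
  ‖g‖ = 1 ∧ ‖Matrix.toEuclideanCLM (n := Fin d) (𝕜 := ℝ) A g‖ = specNorm A

section SDP

/-- The symbolic index set `{1} ∪ {b_i} ∪ {v_j}` of the matrix variable of the semidefinite
program. -/
abbrev Idx (k d : ℕ) : Type := Unit ⊕ (Fin k ⊕ Fin d)

/-- The index `1`. -/
def Idx.one {k d : ℕ} : Idx k d := Sum.inl ()

/-- The index `b_i`. -/
def Idx.b {k d : ℕ} (i : Fin k) : Idx k d := Sum.inr (Sum.inl i)

/-- The index `v_j`. -/
def Idx.v {k d : ℕ} (j : Fin d) : Idx k d := Sum.inr (Sum.inr j)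

/-- The vector `v_{b_i} = (X_{b_i,v_1}, …, X_{b_i,v_d})`. -/
def vb {k d : ℕ} (X : Matrix (Idx k d) (Idx k d) ℝ) (i : Fin k) : Vec d :=
  WithLp.toLp 2 (fun j => X (Idx.b i) (Idx.v j))

/-- The submatrix `X_v` of `X` on the indices `v_1, …, v_d`. -/
def subV {k d : ℕ} (X : Matrix (Idx k d) (Idx k d) ℝ) : Matrix (Fin d) (Fin d) ℝ :=
  X.submatrix Idx.v Idx.v

/-- Feasibility for the semidefinite program `MT(x, r, Z)`. -/
structure MTFeasible {k d : ℕ} (x : Vec d) (r : ℝ) (Z : Fin k → Vec d)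
    (X : Matrix (Idx k d) (Idx k d) ℝ) : Prop where
  one_b : ∀ i, X Idx.one (Idx.b i) = X (Idx.b i) (Idx.b i)
  one_one : X Idx.one Idx.one = 1
  trace_v : ∑ j, X (Idx.v j) (Idx.v j) = 1
  sep : ∀ i, X (Idx.b i) (Idx.b i) * r ≤ inner ℝ (vb X i) (Z i - x)
  psd : X.PosSemidef

/-- The objective `∑ᵢ X_{1,b_i}`. -/
def mtObjective {k d : ℕ} (X : Matrix (Idx k d) (Idx k d) ℝ) : ℝ :=
  ∑ i : Fin k, X Idx.one (Idx.b i)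

/-- `(X, m) = MT(x, r, Z)`: `X` is an optimal solution of the program and `m` the optimal value. -/
def IsMT {k d : ℕ} (x : Vec d) (r : ℝ) (Z : Fin k → Vec d)
    (X : Matrix (Idx k d) (Idx k d) ℝ) (m : ℝ) : Prop :=
  MTFeasible x r Z X ∧ mtObjective X = m ∧ ∀ Y, MTFeasible x r Z Y → mtObjective Y ≤ m

end SDP

section Routines

/-- SDP-based Distance Estimation: `r` is the largest radius for which the optimal value of
`MT(x, r, Z)` is at least `0.9 k`. The radius `0` always qualifies (for `d, k ≥ 1`); it is the
result exactly when no positive radius qualifies. -/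
def DistanceEstimation {k d : ℕ} (Z : Fin k → Vec d) (x : Vec d) (r : ℝ) : Prop :=
  IsGreatest {r : ℝ | 0 ≤ r ∧ ∃ X m, IsMT x r Z X m ∧ (9 / 10 : ℝ) * (k : ℝ) ≤ m} r

open Classical in
/-- SDP-based Gradient Estimation: `g` is a possible result, for some optimal solution of the
program and some top singular vector of its `v`-block. -/
def GradientEstimation {k d : ℕ} (Z : Fin k → Vec d) (x : Vec d) (g : Vec d) : Prop :=
  ∃ (r : ℝ) (X : Matrix (Idx k d) (Idx k d) ℝ) (m : ℝ) (y : Vec d),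
    DistanceEstimation Z x r ∧ IsMT x r Z X m ∧ IsTopSingularVector (subV X) y ∧
    g = if (9 / 10 : ℝ) * (k : ℝ) ≤
          ((Finset.univ.filter (fun i : Fin k => 0 ≤ inner ℝ (Z i - x) y)).card : ℝ)
        then y else -y

end Routines

section Descent

/-- The number of bins, `k = 3200 log (1/δ)`, rounded up. -/
def numBins (δ : ℝ) : ℕ := ⌈3200 * Real.log (1 / δ)⌉₊

/-- The `i`-th of `k` consecutive bins of `n` data points: with points and bins numbered from `0`,
the indices `⌊i n / k⌋ ≤ j < ⌊(i + 1) n / k⌋`. -/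
def bin (n k : ℕ) (i : Fin k) : Finset (Fin n) :=
  Finset.univ.filter (fun j => i.val * n / k ≤ j.val ∧ j.val < (i.val + 1) * n / k)

/-- The bin means `Z_1, …, Z_k`. -/
def binMean {n d : ℕ} (k : ℕ) (X : Fin n → Vec d) (i : Fin k) : Vec d :=
  ((bin n k i).card : ℝ)⁻¹ • ∑ j ∈ bin n k i, X j

/-- The variables of the descent loop: the current iterate `x_t`, the best iterate `x*` so far, and
its distance estimate `d*` (initially `∞`). -/
structure LoopState (d : ℕ) where
  cur : Vec d
  best : Vec d
  bestDist : WithTop ℝ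

open Classical in
/-- `LoopReaches DE GE Z γ t s`: after `t` passes through the loop the variables can have the
values `s`. The routines `DE` and `GE` are given as relations between their inputs and their
possible results. -/
inductive LoopReaches {k d : ℕ} (DE : (Fin k → Vec d) → Vec d → ℝ → Prop)
    (GE : (Fin k → Vec d) → Vec d → Vec d → Prop) (Z : Fin k → Vec d) (γ : ℝ) :
    ℕ → LoopState d → Prop where
  | init : LoopReaches DE GE Z γ 0 ⟨0, 0, ⊤⟩
  | step {t : ℕ} {s : LoopState d} {r : ℝ} {g : Vec d} :
      LoopReaches DE GE Z γ t s → DE Z s.cur r → GE Z s.cur g →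
      LoopReaches DE GE Z γ (t + 1)
        ⟨s.cur + (γ * r) • g,
          if (r : WithTop ℝ) < s.bestDist then s.cur else s.best,
          if (r : WithTop ℝ) < s.bestDist then (r : WithTop ℝ) else s.bestDist⟩

/-- `xstar` is a possible result of Mean Estimation, instantiated with the SDP-based Distance and
Gradient Estimation, on the data `X`, with target confidence `δ`, `T` iterations and stepsize `γ`.
The loop is executed for `t = 0, …, T`. -/
def MeanEstimation {n d : ℕ} (X : Fin n → Vec d) (δ : ℝ) (T : ℕ) (γ : ℝ) (xstar : Vec d) : Prop :=
  ∃ s : LoopState d,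
    LoopReaches DistanceEstimation GradientEstimation (binMean (numBins δ) X) γ (T + 1) s ∧
    xstar = s.best

end Descent

end SubGaussianMean

end

open scoped BigOperators

noncomputable section

namespace SubGaussianMean

open MeasureTheory ProbabilityTheory

/-! ### Gram representations of positive semidefinite matrices -/

/-! A deterministic and a probabilistic half meet in one event: for a radius ρ of the order of the
error bound, the value of MT(μ, ρ, Z) is at most k/20.

Deterministic half. Let D = ‖μ - x‖. On the event, in each direction at most k/20 bin means lie ρ or
further beyond μ. A rank-two point then shows that the distance estimate r is at least √(19/18) (D -
ρ) (`distanceEstimation_lower`). Conversely, let X be feasible at (x, r) with objective at least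
0.9k. The bins whose v_b correlates too little with μ - x would be feasible at (μ, ρ), so they carry
weight at most k/20; the other bins force the v-block to have a quadratic form of at least (17/19)(r
- ρ)² at μ - x (`quadV_lower`). The block has trace one, so this bounds r above by about √(19/17) D.
Together the bounds put the form close to D², so the block is close to rank one and its top singular
vector is close to ±(μ - x)/D; counting bins fixes the sign (`gradientEstimation_inner`). While D ≥
120ρ, a step therefore multiplies D by at most 0.952 and strictly lowers the distance estimate
(`descent_step`). Hence the best iterate is the most recent one until some estimate is at most 128ρ,
and a small estimate certifies a small distance.

Probabilistic half. The value of the program at μ is at most `clampSup`, a supremum of sums of terms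
in [0, 1], one for each bin. Random signs round the relaxation to the supremum of ∑ |⟨u, Z_i - μ⟩|
over unit vectors with a loss of 7/4 (`sum_sqrt_le_absSup`); symmetrization and contraction bound
the mean of that supremum by the trace and the spectral norm of the covariance
(`integral_absSup_le`). Changing one bin moves `clampSup` by at most 1, so McDiarmid's inequality
gives the probability exp(-k/3200) ≤ δ. -/

theorem posSemidef_iff_exists_gram {ι : Type*} [Fintype ι] {M : Matrix ι ι ℝ} :
    M.PosSemidef ↔ ∃ (m : ℕ) (B : Fin m → ι → ℝ), ∀ i j, M i j = ∑ l, B l i * B l j := by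
  rw [Matrix.posSemidef_iff_eq_sum_vecMulVec]
  constructor
  · rintro ⟨m, v, rfl⟩
    exact ⟨m, v, fun i j => by simp [Matrix.sum_apply, Matrix.vecMulVec_apply]⟩
  · rintro ⟨m, v, h⟩
    refine ⟨m, v, ?_⟩
    ext i j
    simp [Matrix.sum_apply, Matrix.vecMulVec_apply, h]

theorem posSemidef_entry_sq_le {ι : Type*} [Fintype ι] {M : Matrix ι ι ℝ} (h : M.PosSemidef)
    (i j : ι) : M i j ^ 2 ≤ M i i * M j j := by
  obtain ⟨m, B, hB⟩ := posSemidef_iff_exists_gram.1 h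
  rw [hB, hB, hB]
  simpa [sq] using Finset.sum_mul_sq_le_sq_mul_sq Finset.univ (fun l => B l i) (fun l => B l j)

/-- Each Gram vector is rescaled coordinatewise. With `c` valued in {0, 1} this erases rows and
columns, so bins can be dropped from a feasible point. -/
theorem posSemidef_mul_mask {ι : Type*} [Fintype ι] {M : Matrix ι ι ℝ} (h : M.PosSemidef)
    (c : ι → ℝ) : (Matrix.of fun i j => c i * c j * M i j).PosSemidef := by
  obtain ⟨m, B, hB⟩ := posSemidef_iff_exists_gram.1 h
  refine posSemidef_iff_exists_gram.2 ⟨m, fun l i => c i * B l i, fun i j => ?_⟩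
  simp only [Matrix.of_apply, hB, Finset.mul_sum]
  exact Finset.sum_congr rfl fun l _ => by ring

theorem isClosed_posSemidef {ι : Type*} [Fintype ι] :
    IsClosed {M : Matrix ι ι ℝ | M.PosSemidef} := by
  have : {M : Matrix ι ι ℝ | M.PosSemidef} =
      {M | M.conjTranspose = M} ∩ ⋂ x : ι → ℝ, {M | 0 ≤ star x ⬝ᵥ M.mulVec x} := by
    ext M
    simp [Matrix.posSemidef_iff_dotProduct_mulVec, Matrix.IsHermitian]
  rw [this]
  refine (isClosed_eq (by fun_prop) continuous_id).inter (isClosed_iInter fun x => ?_)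
  exact isClosed_le continuous_const (by fun_prop)

/-! ### Feasible points of the semidefinite program -/

section Feasible

variable {k d : ℕ} {x : Vec d} {r : ℝ} {Z : Fin k → Vec d} {X : Matrix (Idx k d) (Idx k d) ℝ}

theorem inner_vb (X : Matrix (Idx k d) (Idx k d) ℝ) (i : Fin k) (y : Vec d) :
    inner ℝ (vb X i) y = ∑ j, X (Idx.b i) (Idx.v j) * y j := by
  simp [vb, PiLp.inner_apply, mul_comm]

theorem MTFeasible.diag_b_nonneg (h : MTFeasible x r Z X) (i : Fin k) :
    0 ≤ X (Idx.b i) (Idx.b i) := h.psd.diag_nonneg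

theorem MTFeasible.diag_b_le_one (h : MTFeasible x r Z X) (i : Fin k) :
    X (Idx.b i) (Idx.b i) ≤ 1 := by
  have h1 := posSemidef_entry_sq_le h.psd Idx.one (Idx.b i)
  rw [h.one_b, h.one_one, one_mul] at h1
  nlinarith

theorem MTFeasible.objective_eq (h : MTFeasible x r Z X) :
    mtObjective X = ∑ i, X (Idx.b i) (Idx.b i) :=
  Finset.sum_congr rfl fun i _ => h.one_b i

theorem MTFeasible.diag_le_one (h : MTFeasible x r Z X) (a : Idx k d) : X a a ≤ 1 := by
  rcases a with a | i | j
  · exact h.one_one.le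
  · exact h.diag_b_le_one i
  · rw [← h.trace_v]
    exact Finset.single_le_sum (f := fun j => X (Idx.v j) (Idx.v j))
      (fun _ _ => h.psd.diag_nonneg) (Finset.mem_univ j)

theorem MTFeasible.entry_mem (h : MTFeasible x r Z X) (a b : Idx k d) :
    X a b ∈ Set.Icc (-1 : ℝ) 1 := by
  have h1 := posSemidef_entry_sq_le h.psd a b
  have h2 : X a a * X b b ≤ 1 :=
    mul_le_one₀ (h.diag_le_one a) h.psd.diag_nonneg (h.diag_le_one b)
  exact abs_le.1 (abs_le_one_iff_mul_self_le_one.2 (by nlinarith))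

/-- The quadratic form of the `v`-block. -/
def quadV (X : Matrix (Idx k d) (Idx k d) ℝ) (w : Vec d) : ℝ :=
  ∑ i, ∑ j, w i * X (Idx.v i) (Idx.v j) * w j

theorem quadV_gram {m : ℕ} {B : Fin m → Idx k d → ℝ}
    (hB : ∀ a b, X a b = ∑ l, B l a * B l b) (w : Vec d) :
    quadV X w = ∑ l, (∑ j, B l (Idx.v j) * w j) ^ 2 := by
  calc quadV X w = ∑ i, ∑ j, ∑ l, (B l (Idx.v i) * w i) * (B l (Idx.v j) * w j) := by
        refine Finset.sum_congr rfl fun i _ => Finset.sum_congr rfl fun j _ => ?_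
        rw [hB, Finset.mul_sum, Finset.sum_mul]
        exact Finset.sum_congr rfl fun l _ => by ring
    _ = ∑ i, ∑ l, ∑ j, (B l (Idx.v i) * w i) * (B l (Idx.v j) * w j) :=
        Finset.sum_congr rfl fun i _ => Finset.sum_comm
    _ = ∑ l, ∑ i, ∑ j, (B l (Idx.v i) * w i) * (B l (Idx.v j) * w j) := Finset.sum_comm
    _ = _ := Finset.sum_congr rfl fun l _ => by rw [sq, Finset.sum_mul_sum]

theorem inner_vb_gram {m : ℕ} {B : Fin m → Idx k d → ℝ}
    (hB : ∀ a b, X a b = ∑ l, B l a * B l b) (i : Fin k) (w : Vec d) :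
    inner ℝ (vb X i) w = ∑ l, B l (Idx.b i) * ∑ j, B l (Idx.v j) * w j := by
  rw [inner_vb]
  simp only [hB, Finset.sum_mul, Finset.mul_sum]
  rw [Finset.sum_comm]
  exact Finset.sum_congr rfl fun l _ => Finset.sum_congr rfl fun j _ => by ring

theorem inner_vb_sq_le (h : X.PosSemidef) (i : Fin k) (w : Vec d) :
    inner ℝ (vb X i) w ^ 2 ≤ X (Idx.b i) (Idx.b i) * quadV X w := by
  obtain ⟨m, B, hB⟩ := posSemidef_iff_exists_gram.1 h
  rw [inner_vb_gram hB, quadV_gram hB, hB]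
  simpa [sq] using Finset.sum_mul_sq_le_sq_mul_sq Finset.univ (fun l => B l (Idx.b i))
    (fun l => ∑ j, B l (Idx.v j) * w j)

theorem quadV_nonneg (h : X.PosSemidef) (w : Vec d) : 0 ≤ quadV X w := by
  obtain ⟨m, B, hB⟩ := posSemidef_iff_exists_gram.1 h
  rw [quadV_gram hB]
  positivity

/-- The trace of a positive semidefinite matrix dominates its operator norm, and the trace of the
v-block is one. -/
theorem MTFeasible.quadV_le (h : MTFeasible x r Z X) (w : Vec d) : quadV X w ≤ ‖w‖ ^ 2 := by
  obtain ⟨m, B, hB⟩ := posSemidef_iff_exists_gram.1 h.psd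
  have h1 := h.trace_v
  simp only [hB] at h1
  rw [quadV_gram hB, EuclideanSpace.real_norm_sq_eq]
  calc ∑ l, (∑ j, B l (Idx.v j) * w j) ^ 2
      ≤ ∑ l, (∑ j, B l (Idx.v j) ^ 2) * ∑ j, w j ^ 2 :=
        Finset.sum_le_sum fun l _ => Finset.sum_mul_sq_le_sq_mul_sq _ _ _
    _ = ∑ j, w j ^ 2 := by
        rw [← Finset.sum_mul, Finset.sum_comm]
        simp only [sq]
        rw [h1, one_mul]

theorem MTFeasible.abs_inner_vb_le (h : MTFeasible x r Z X) (i : Fin k) (w : Vec d) :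
    |inner ℝ (vb X i) w| ≤ ‖w‖ := by
  apply abs_le_of_sq_le_sq _ (norm_nonneg _)
  calc _ ≤ X (Idx.b i) (Idx.b i) * quadV X w := inner_vb_sq_le h.psd i w
    _ ≤ 1 * ‖w‖ ^ 2 := mul_le_mul (h.diag_b_le_one i) (h.quadV_le w) (quadV_nonneg h.psd w) one_pos.le
    _ = _ := one_mul _

/-- Setting some of the `b`-rows and -columns of a feasible point to zero, and moving the centre. -/
theorem MTFeasible.sum_le_of_subset (h : MTFeasible x r Z X) {y : Vec d} {ρ c : ℝ}
    (hc : ∀ Y, MTFeasible y ρ Z Y → mtObjective Y ≤ c) (S : Finset (Fin k))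
    (hS : ∀ i ∈ S, X (Idx.b i) (Idx.b i) * ρ ≤ inner ℝ (vb X i) (Z i - y)) :
    ∑ i ∈ S, X (Idx.b i) (Idx.b i) ≤ c := by
  classical
  let m : Idx k d → ℝ := Sum.elim 1 (Sum.elim (fun i => if i ∈ S then 1 else 0) 1)
  have m1 : m Idx.one = 1 := rfl
  have mv : ∀ j, m (Idx.v j) = 1 := fun _ => rfl
  have mb : ∀ i, m (Idx.b i) = if i ∈ S then 1 else 0 := fun _ => rfl
  let Y : Matrix (Idx k d) (Idx k d) ℝ := Matrix.of fun a b => m a * m b * X a b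
  have hYb : ∀ i, Y (Idx.b i) (Idx.b i) = if i ∈ S then X (Idx.b i) (Idx.b i) else 0 := by
    intro i
    by_cases hi : i ∈ S <;> simp [Y, mb, hi]
  have hvb : ∀ i, vb Y i = if i ∈ S then vb X i else 0 := by
    intro i
    ext j
    by_cases hi : i ∈ S <;> simp [vb, Y, mb, mv, hi]
  have hY : MTFeasible y ρ Z Y :=
    { one_b := fun i => by
        rw [hYb]
        by_cases hi : i ∈ S <;> simp [Y, mb, m1, hi, h.one_b]
      one_one := by simp [Y, m1, h.one_one]
      trace_v := by simp [Y, mv, h.trace_v]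
      sep := fun i => by
        rw [hYb, hvb]
        by_cases hi : i ∈ S
        · simpa [hi] using hS i hi
        · simp [hi]
      psd := posSemidef_mul_mask h.psd m }
  have := hc Y hY
  rwa [hY.objective_eq, Finset.sum_congr rfl fun i _ => hYb i, ← Finset.sum_filter,
    Finset.filter_mem_eq_inter, Finset.univ_inter] at this

/-- The feasible point of rank two that selects the bins in `S` with weight `q ^ 2` and puts the
whole `v`-block on the direction `u`. -/
theorem exists_feasible_of_direction (x : Vec d) (r : ℝ) (Z : Fin k → Vec d) {u : Vec d}
    (hu : ‖u‖ = 1) {q : ℝ} (hq0 : 0 ≤ q) (hq1 : q ≤ 1) (S : Finset (Fin k))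
    (hS : ∀ i ∈ S, q * r ≤ inner ℝ u (Z i - x)) :
    ∃ X, MTFeasible x r Z X ∧ mtObjective X = S.card * q ^ 2 := by
  classical
  -- X is the Gram matrix of `f` and `g`. Since q² + t² = 1, on S it has X_bb = q⁴ + q²t² = q² and
  -- v_b = (q³ + qt²)u = qu, and its v-block is uuᵀ. Thus lowering the weight to q² shrinks v_b only
  -- by q, and the admissible radius grows by 1/q.
  set t := Real.sqrt (1 - q ^ 2) with ht
  have ht2 : t * t = 1 - q ^ 2 := Real.mul_self_sqrt (by nlinarith)
  let f : Idx k d → ℝ := Sum.elim 1 (Sum.elim (fun i => if i ∈ S then q ^ 2 else 0) fun j => u j * q)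
  let g : Idx k d → ℝ := Sum.elim 0 (Sum.elim (fun i => if i ∈ S then q * t else 0) fun j => u j * t)
  let X : Matrix (Idx k d) (Idx k d) ℝ := Matrix.of fun a b => f a * f b + g a * g b
  have hu2 : ∑ j, u j * u j = 1 := by
    have := EuclideanSpace.real_norm_sq_eq u
    rw [hu] at this
    simpa [sq] using this.symm
  have h1b : ∀ i, X Idx.one (Idx.b i) = if i ∈ S then q ^ 2 else 0 := fun i => by
    simp [X, f, g, Idx.one, Idx.b]
  have hbb : ∀ i, X (Idx.b i) (Idx.b i) = if i ∈ S then q ^ 2 else 0 := fun i => by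
    by_cases hi : i ∈ S
    · simp only [X, f, g, Idx.b, hi, Matrix.of_apply, Sum.elim_inr, Sum.elim_inl, if_true]
      linear_combination q ^ 2 * ht2
    · simp [X, f, g, Idx.b, hi]
  have hvb : ∀ i, vb X i = if i ∈ S then q • u else 0 := fun i => by
    ext j
    by_cases hi : i ∈ S
    · simp only [X, f, g, Idx.b, Idx.v, vb, hi, Matrix.of_apply, Sum.elim_inr, Sum.elim_inl, if_true,
        PiLp.smul_apply, smul_eq_mul]
      linear_combination q * u j * ht2
    · simp [X, f, g, Idx.b, Idx.v, vb, hi]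
  refine ⟨X, ⟨fun i => by rw [h1b, hbb], by simp [X, f, g, Idx.one], ?_, fun i => ?_, ?_⟩, ?_⟩
  · rw [← hu2]
    refine Finset.sum_congr rfl fun j _ => ?_
    simp only [X, f, g, Idx.v, Matrix.of_apply, Sum.elim_inr]
    linear_combination u j * u j * ht2
  · rw [hbb, hvb]
    by_cases hi : i ∈ S
    · simp only [hi, if_true, inner_smul_left, RCLike.conj_to_real]
      nlinarith [hS i hi]
    · simp [hi]
  · exact posSemidef_iff_exists_gram.2 ⟨2, ![f, g], fun a b => by simp [X, Fin.sum_univ_two]⟩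
  · simp [mtObjective, h1b, Finset.sum_ite_mem]

/-- With v_b = 0 separation at radius 0 is trivial, so every bin gets weight one; `u` only supplies
the trace. The radius 0 therefore always qualifies. -/
theorem exists_feasible_zero (x : Vec d) (Z : Fin k → Vec d) {u : Vec d} (hu : ‖u‖ = 1) :
    ∃ X, MTFeasible x 0 Z X ∧ mtObjective X = k := by
  let f : Idx k d → ℝ := Sum.elim 1 (Sum.elim 1 0)
  let g : Idx k d → ℝ := Sum.elim 0 (Sum.elim 0 u)
  let X : Matrix (Idx k d) (Idx k d) ℝ := Matrix.of fun a b => f a * f b + g a * g b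
  have hu2 : ∑ j, u j * u j = 1 := by
    have := EuclideanSpace.real_norm_sq_eq u
    rw [hu] at this
    simpa [sq] using this.symm
  refine ⟨X, ⟨fun i => by simp [X, f, g, Idx.one, Idx.b], by simp [X, f, g, Idx.one], ?_,
    fun i => ?_, ?_⟩, by simp [mtObjective, X, f, g, Idx.one, Idx.b]⟩
  · simpa [X, f, g, Idx.v] using hu2
  · have : vb X i = 0 := by
      ext j
      simp [X, f, g, vb, Idx.b, Idx.v]
    simp [this]
  · exact posSemidef_iff_exists_gram.2 ⟨2, ![f, g], fun a b => by simp [X, Fin.sum_univ_two]⟩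

end Feasible

/-! ### Existence of the maxima -/

section Existence

variable {k d : ℕ}

theorem exists_unit (hd : 0 < d) : ∃ u : Vec d, ‖u‖ = 1 :=
  ⟨EuclideanSpace.single ⟨0, hd⟩ 1, by simp⟩

theorem continuous_entry (a b : Idx k d) :
    Continuous fun X : Matrix (Idx k d) (Idx k d) ℝ => X a b := by fun_prop

theorem continuous_mtObjective :
    Continuous (mtObjective : Matrix (Idx k d) (Idx k d) ℝ → ℝ) :=
  continuous_finsetSum _ fun _ _ => continuous_entry _ _

/-- Closedness is joint in the radius and the matrix because Distance Estimation maximizes over the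
radius as well. -/
theorem isClosed_feasible (x : Vec d) (Z : Fin k → Vec d) :
    IsClosed {p : ℝ × Matrix (Idx k d) (Idx k d) ℝ | MTFeasible x p.1 Z p.2} := by
  have : {p : ℝ × Matrix (Idx k d) (Idx k d) ℝ | MTFeasible x p.1 Z p.2} =
      ((⋂ i, {p : ℝ × Matrix (Idx k d) (Idx k d) ℝ | p.2 Idx.one (Idx.b i) = p.2 (Idx.b i) (Idx.b i)}) ∩
        ({p : ℝ × Matrix (Idx k d) (Idx k d) ℝ | p.2 Idx.one Idx.one = 1} ∩
        ({p : ℝ × Matrix (Idx k d) (Idx k d) ℝ | ∑ j, p.2 (Idx.v j) (Idx.v j) = 1} ∩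
        ((⋂ i, {p : ℝ × Matrix (Idx k d) (Idx k d) ℝ | p.2 (Idx.b i) (Idx.b i) * p.1 ≤ inner ℝ (vb p.2 i) (Z i - x)}) ∩
        (Prod.snd ⁻¹' {M | M.PosSemidef}))))) := by
    ext p
    simp only [Set.mem_ofPred_eq, Set.mem_inter_iff, Set.mem_iInter, Set.mem_preimage]
    exact ⟨fun h => ⟨h.one_b, h.one_one, h.trace_v, h.sep, h.psd⟩,
      fun h => ⟨h.1, h.2.1, h.2.2.1, h.2.2.2.1, h.2.2.2.2⟩⟩
  rw [this]
  have he : ∀ a b, Continuous fun p : ℝ × Matrix (Idx k d) (Idx k d) ℝ => p.2 a b :=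
    fun a b => (continuous_entry a b).comp continuous_snd
  refine (isClosed_iInter fun i => isClosed_eq (he _ _) (he _ _)).inter
    ((isClosed_eq (he _ _) continuous_const).inter
    ((isClosed_eq (continuous_finsetSum _ fun _ _ => he _ _) continuous_const).inter
    ((isClosed_iInter fun i => isClosed_le ((he _ _).mul continuous_fst) ?_).inter
    (isClosed_posSemidef.preimage continuous_snd))))
  simp only [inner_vb]
  exact continuous_finsetSum _ fun _ _ => (he _ _).mul continuous_const

theorem isCompact_entries :
    IsCompact {X : Matrix (Idx k d) (Idx k d) ℝ | ∀ a b, X a b ∈ Set.Icc (-1 : ℝ) 1} := by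
  have := isCompact_univ_pi (X := fun _ : Idx k d => Idx k d → ℝ)
    (s := fun _ => Set.univ.pi fun _ => Set.Icc (-1 : ℝ) 1)
    fun _ => isCompact_univ_pi fun _ => isCompact_Icc
  refine (congrArg IsCompact (Set.ext fun X => ?_)).mpr this
  exact ⟨fun h a _ b _ => h a b, fun h a b => h a trivial b trivial⟩

theorem exists_isMT {x : Vec d} {r : ℝ} {Z : Fin k → Vec d}
    (h : ∃ X, MTFeasible x r Z X) : ∃ X m, IsMT x r Z X m := by
  have hc : IsCompact {X | MTFeasible x r Z X} := by
    refine isCompact_entries.of_isClosed_subset ?_ fun X hX => hX.entry_mem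
    exact (isClosed_feasible x Z).preimage (f := fun X => (r, X)) (by fun_prop)
  obtain ⟨X, hX, hmax⟩ := hc.exists_isMaxOn h continuous_mtObjective.continuousOn
  exact ⟨X, _, hX, rfl, fun Y hY => hmax hY⟩

theorem qualifies_iff (x : Vec d) (r : ℝ) (Z : Fin k → Vec d) :
    (∃ X m, IsMT x r Z X m ∧ (9 / 10 : ℝ) * (k : ℝ) ≤ m) ↔
      ∃ X, MTFeasible x r Z X ∧ (9 / 10 : ℝ) * (k : ℝ) ≤ mtObjective X := by
  constructor
  · rintro ⟨X, m, h, hm⟩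
    exact ⟨X, h.1, h.2.1.symm ▸ hm⟩
  · rintro ⟨Y, hY, hm⟩
    obtain ⟨X, m, h⟩ := exists_isMT ⟨Y, hY⟩
    exact ⟨X, m, h, hm.trans (h.2.2 Y hY)⟩

theorem MTFeasible.objective_mul_le {x : Vec d} {r : ℝ} {Z : Fin k → Vec d}
    {X : Matrix (Idx k d) (Idx k d) ℝ} (h : MTFeasible x r Z X) :
    mtObjective X * r ≤ ∑ i, ‖Z i - x‖ := by
  rw [h.objective_eq, Finset.sum_mul]
  exact Finset.sum_le_sum fun i _ =>
    (h.sep i).trans ((le_abs_self _).trans (h.abs_inner_vb_le i _))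

/-- The qualifying radii are the projection of a compact set of pairs (r, X). The radius is bounded
because r times the objective is at most ∑ ‖Z_i - x‖, while the objective is at least 0.9k. -/
theorem exists_distanceEstimation (hd : 0 < d) (hk : 0 < k) (Z : Fin k → Vec d) (x : Vec d) :
    ∃ r, DistanceEstimation Z x r := by
  have hk' : (0 : ℝ) < k := by exact_mod_cast hk
  set R := (∑ i, ‖Z i - x‖) / (9 / 10 * k) with hR
  let K : Set (ℝ × Matrix (Idx k d) (Idx k d) ℝ) :=
    {p | 0 ≤ p.1} ∩ ({p | MTFeasible x p.1 Z p.2} ∩ {p | (9 / 10 : ℝ) * (k : ℝ) ≤ mtObjective p.2})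
  have hKc : IsCompact K := by
    refine (isCompact_Icc.prod isCompact_entries : IsCompact (Set.Icc 0 R ×ˢ
      {X : Matrix (Idx k d) (Idx k d) ℝ | ∀ a b, X a b ∈ Set.Icc (-1 : ℝ) 1})).of_isClosed_subset
      ?_ ?_
    · exact (isClosed_le continuous_const continuous_fst).inter ((isClosed_feasible x Z).inter
        (isClosed_le continuous_const (continuous_mtObjective.comp continuous_snd)))
    · rintro ⟨r, X⟩ ⟨h0, hX, hm⟩
      refine ⟨⟨h0, ?_⟩, hX.entry_mem⟩
      rw [hR, le_div_iff₀ (by positivity)]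
      have := hX.objective_mul_le
      have h0' : 0 ≤ r := h0
      have hm' : (9 / 10 : ℝ) * (k : ℝ) ≤ mtObjective X := hm
      dsimp only
      nlinarith
  have himg : Prod.fst '' K =
      {r : ℝ | 0 ≤ r ∧ ∃ X m, IsMT x r Z X m ∧ (9 / 10 : ℝ) * (k : ℝ) ≤ m} := by
    ext r
    simp only [qualifies_iff]
    constructor
    · rintro ⟨⟨r, X⟩, ⟨h0, hX, hm⟩, rfl⟩
      exact ⟨h0, X, hX, hm⟩
    · rintro ⟨h0, X, hX, hm⟩
      exact ⟨(r, X), ⟨h0, hX, hm⟩, rfl⟩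
  have hne : K.Nonempty := by
    obtain ⟨u, hu⟩ := exists_unit hd
    obtain ⟨X, hX, hm⟩ := exists_feasible_zero x Z hu
    exact ⟨(0, X), le_refl (0 : ℝ), hX, by simp only [Set.mem_ofPred_eq, hm]; linarith⟩
  unfold DistanceEstimation
  rw [← himg]
  exact (hKc.image continuous_fst).exists_isGreatest (hne.image _)

theorem exists_isTopSingularVector (hd : 0 < d) (A : Matrix (Fin d) (Fin d) ℝ) :
    ∃ g : Vec d, IsTopSingularVector A g := by
  set T := Matrix.toEuclideanCLM (n := Fin d) (𝕜 := ℝ) A with hT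
  obtain ⟨u, hu⟩ := exists_unit hd
  obtain ⟨g, hg, hmax⟩ := (isCompact_sphere (0 : Vec d) 1).exists_isMaxOn ⟨u, by simpa using hu⟩
    (f := fun z => ‖T z‖) (by fun_prop)
  have hg1 : ‖g‖ = 1 := by simpa using hg
  refine ⟨g, hg1, le_antisymm ?_ ?_⟩
  · have := T.le_opNorm g
    rwa [hg1, mul_one] at this
  · refine T.opNorm_le_bound (norm_nonneg _) fun z => ?_
    rcases eq_or_ne z 0 with rfl | hz
    · simp
    · have hz' : 0 < ‖z‖ := norm_pos_iff.2 hz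
      have h1 : ‖T (‖z‖⁻¹ • z)‖ ≤ ‖T g‖ :=
        hmax (by simp [norm_smul, hz'.ne'])
      rw [map_smul, norm_smul, norm_inv, norm_norm, inv_mul_le_iff₀ hz'] at h1
      linarith

theorem exists_gradientEstimation (hd : 0 < d) (hk : 0 < k) (Z : Fin k → Vec d) (x : Vec d) :
    ∃ g, GradientEstimation Z x g := by
  obtain ⟨r, hr⟩ := exists_distanceEstimation hd hk Z x
  obtain ⟨X, m, hX, -⟩ := hr.1.2
  obtain ⟨y, hy⟩ := exists_isTopSingularVector hd (subV X)
  exact ⟨_, r, X, m, y, hr, hX, hy, rfl⟩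

theorem exists_loopReaches (hd : 0 < d) (hk : 0 < k) (Z : Fin k → Vec d) (γ : ℝ) (t : ℕ) :
    ∃ s, LoopReaches DistanceEstimation GradientEstimation Z γ t s := by
  induction t with
  | zero => exact ⟨_, .init⟩
  | succ t ih =>
    obtain ⟨s, hs⟩ := ih
    obtain ⟨r, hr⟩ := exists_distanceEstimation hd hk Z s.cur
    obtain ⟨g, hg⟩ := exists_gradientEstimation hd hk Z s.cur
    exact ⟨_, .step hs hr hg⟩

end Existence

/-! ### Top singular vectors of positive semidefinite matrices -/

section TopSingular

variable {E : Type*} [NormedAddCommGroup E] [InnerProductSpace ℝ E]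

/-- T is positive semidefinite of trace one. A top singular vector y is an eigenvector with
eigenvalue ‖T‖, and removing it leaves trace 1 - ‖T‖ for everything orthogonal to y. Working with
the vectors `V l` makes a full spectral decomposition unnecessary. -/
theorem sum_inner_sq_le_of_top {m : ℕ} (V : Fin m → E) (T : E →L[ℝ] E)
    (hT : ∀ w, T w = ∑ l, inner ℝ (V l) w • V l) (hV : ∑ l, ‖V l‖ ^ 2 = 1)
    {y : E} (hy : ‖y‖ = 1) (hTy : ‖T y‖ = ‖T‖) (w : E) :
    ∑ l, inner ℝ (V l) w ^ 2 ≤ ‖T‖ * ‖w‖ ^ 2 ∧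
    ∑ l, inner ℝ (V l) w ^ 2 ≤ ‖T‖ * inner ℝ y w ^ 2 + (1 - ‖T‖) * ‖w‖ ^ 2 := by
  set N := ‖T‖ with hN
  have hN0 : 0 ≤ N := norm_nonneg _
  have hinner : ∀ w z, inner ℝ (T w) z = ∑ l, inner ℝ (V l) w * inner ℝ (V l) z := by
    intro w z
    simp [hT, sum_inner, inner_smul_left]
  have hquad : ∀ w, ∑ l, inner ℝ (V l) w ^ 2 = inner ℝ (T w) w := by
    intro w
    simp [hinner, sq]
  have hle : ∀ w, ∑ l, inner ℝ (V l) w ^ 2 ≤ N * ‖w‖ ^ 2 := by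
    intro w
    rw [hquad]
    calc _ ≤ ‖T w‖ * ‖w‖ := real_inner_le_norm _ _
      _ ≤ (N * ‖w‖) * ‖w‖ := mul_le_mul_of_nonneg_right (T.le_opNorm w) (norm_nonneg _)
      _ = _ := by ring
  refine ⟨hle w, ?_⟩
  have hqy : ∑ l, inner ℝ (V l) y ^ 2 = N := by
    refine le_antisymm (by simpa [hy] using hle y) ?_
    rcases hN0.eq_or_lt with h0 | h0
    · rw [← h0]; positivity
    -- Cauchy–Schwarz for the form of T at y and Ty: N⁴ ≤ ⟨Ty, y⟩ · N · N², whence ⟨Ty, y⟩ ≥ N.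
    have h1 : (inner ℝ (T y) (T y)) ^ 2 ≤
        (∑ l, inner ℝ (V l) y ^ 2) * ∑ l, inner ℝ (V l) (T y) ^ 2 := by
      rw [hinner]
      exact Finset.sum_mul_sq_le_sq_mul_sq _ _ _
    rw [real_inner_self_eq_norm_sq, hTy] at h1
    have h2 := hle (T y)
    rw [hTy] at h2
    have h3 : (N ^ 2) ^ 2 ≤ (∑ l, inner ℝ (V l) y ^ 2) * (N * N ^ 2) :=
      h1.trans (mul_le_mul_of_nonneg_left h2 (by positivity))
    have h4 : 0 < N ^ 3 := by positivity
    nlinarith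
  have heig : T y = N • y := by
    rw [← sub_eq_zero, ← norm_eq_zero, ← sq_eq_zero_iff, norm_sub_sq_real, hTy, inner_smul_right,
      ← hquad, hqy, norm_smul, hy, Real.norm_of_nonneg hN0]
    ring
  have hP : ∑ l, ‖V l - inner ℝ (V l) y • y‖ ^ 2 = 1 - N := by
    rw [← hV, ← hqy, ← Finset.sum_sub_distrib]
    refine Finset.sum_congr rfl fun l _ => ?_
    rw [norm_sub_sq_real, inner_smul_right, norm_smul, hy, mul_one, Real.norm_eq_abs, sq_abs]
    ring
  -- The eigenvector equation is what kills the mixed terms between y and its complement.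
  have hcross : ∑ l, inner ℝ (V l) y * inner ℝ (V l - inner ℝ (V l) y • y) w = 0 := by
    simp only [inner_sub_left, inner_smul_left, mul_sub, Finset.sum_sub_distrib, RCLike.conj_to_real]
    rw [← hinner, heig, inner_smul_left, RCLike.conj_to_real, sub_eq_zero, ← hqy, Finset.sum_mul]
    exact Finset.sum_congr rfl fun l _ => by ring
  calc ∑ l, inner ℝ (V l) w ^ 2
      = ∑ l, (inner ℝ (V l) y ^ 2 * inner ℝ y w ^ 2 +
          2 * inner ℝ y w * (inner ℝ (V l) y * inner ℝ (V l - inner ℝ (V l) y • y) w) +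
          inner ℝ (V l - inner ℝ (V l) y • y) w ^ 2) := by
        refine Finset.sum_congr rfl fun l _ => ?_
        simp only [inner_sub_left, inner_smul_left, RCLike.conj_to_real]
        ring
    _ = N * inner ℝ y w ^ 2 + ∑ l, inner ℝ (V l - inner ℝ (V l) y • y) w ^ 2 := by
        rw [Finset.sum_add_distrib, Finset.sum_add_distrib, ← Finset.mul_sum, hcross,
          ← Finset.sum_mul, hqy]
        ring
    _ ≤ N * inner ℝ y w ^ 2 + ∑ l, ‖V l - inner ℝ (V l) y • y‖ ^ 2 * ‖w‖ ^ 2 := by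
        gcongr with l _
        rw [← mul_pow, ← sq_abs]
        exact pow_le_pow_left₀ (abs_nonneg _) (abs_real_inner_le_norm _ _) 2
    _ = _ := by rw [← Finset.sum_mul, hP]

end TopSingular

/-! ### Deterministic analysis of the descent. -/

section Descent

variable {k d : ℕ} {x μ : Vec d} {r ρ : ℝ} {Z : Fin k → Vec d}
  {X : Matrix (Idx k d) (Idx k d) ℝ}

theorem MTFeasible.quadV_le_of_top (h : MTFeasible x r Z X) {y : Vec d}
    (hy : IsTopSingularVector (subV X) y) (w : Vec d) :
    quadV X w ≤ specNorm (subV X) * ‖w‖ ^ 2 ∧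
    quadV X w ≤ specNorm (subV X) * inner ℝ y w ^ 2 + (1 - specNorm (subV X)) * ‖w‖ ^ 2 := by
  obtain ⟨m, B, hB⟩ := posSemidef_iff_exists_gram.1 h.psd
  let V : Fin m → Vec d := fun l => WithLp.toLp 2 fun j => B l (Idx.v j)
  have hV : ∀ l (w : Vec d), inner ℝ (V l) w = ∑ j, B l (Idx.v j) * w j := fun l w => by
    simp [V, PiLp.inner_apply, mul_comm]
  have hq : quadV X w = ∑ l, inner ℝ (V l) w ^ 2 := by
    rw [quadV_gram hB]
    simp only [hV]
  rw [hq]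
  refine sum_inner_sq_le_of_top V (Matrix.toEuclideanCLM (n := Fin d) (𝕜 := ℝ) (subV X)) ?_ ?_
    hy.1 hy.2 w
  · intro w
    ext i
    rw [Matrix.ofLp_toEuclideanCLM]
    simp only [Matrix.mulVec, dotProduct, subV, Matrix.submatrix_apply, hB, WithLp.ofLp_sum,
      WithLp.ofLp_smul, Finset.sum_apply, Pi.smul_apply, smul_eq_mul, hV, Finset.sum_mul]
    rw [Finset.sum_comm]
    exact Finset.sum_congr rfl fun l _ => Finset.sum_congr rfl fun j _ => by simp [V]; ring
  · have := h.trace_v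
    simp only [hB] at this
    rw [Finset.sum_comm] at this
    rw [← this]
    refine Finset.sum_congr rfl fun l _ => ?_
    rw [EuclideanSpace.real_norm_sq_eq]
    exact Finset.sum_congr rfl fun j _ => by simp [V, sq]

/-! ### Consequences of a small optimal value at the mean -/

/-- Giving full weight to the bins in S along u is feasible at (μ, ρ), and its objective is the
number of those bins. -/
theorem card_far_le (hC : ∀ Y, MTFeasible μ ρ Z Y → mtObjective Y ≤ k / 20) {u : Vec d}
    (hu : ‖u‖ = 1) (S : Finset (Fin k)) (hS : ∀ i ∈ S, ρ ≤ inner ℝ u (Z i - μ)) :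
    (S.card : ℝ) ≤ k / 20 := by
  obtain ⟨X, hX, hm⟩ := exists_feasible_of_direction μ ρ Z hu zero_le_one le_rfl S
    (by simpa using hS)
  have := hC X hX
  rw [hm] at this
  simpa using this

theorem card_near_ge (hC : ∀ Y, MTFeasible μ ρ Z Y → mtObjective Y ≤ k / 20) {u : Vec d}
    (hu : ‖u‖ = 1) (S : Finset (Fin k)) (hS : ∀ i, inner ℝ u (Z i - μ) < ρ → i ∈ S) :
    (19 / 20 : ℝ) * k ≤ S.card := by
  classical
  have h1 := card_far_le hC hu Sᶜ fun i hi => by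
    by_contra! h
    exact (Finset.mem_compl.1 hi) (hS i h)
  have h2 := S.card_add_card_compl
  rw [Fintype.card_fin] at h2
  have h3 : (S.card : ℝ) + Sᶜ.card = k := by exact_mod_cast h2
  linarith

/-- At least 19k/20 bins are at depth D - ρ or more in the direction of μ, but an objective of 0.9k
suffices. The surplus is traded for a larger radius. -/
theorem distanceEstimation_lower (hC : ∀ Y, MTFeasible μ ρ Z Y → mtObjective Y ≤ k / 20)
    (hr : DistanceEstimation Z x r) (hρ : 0 < ρ) (hD : ρ ≤ ‖μ - x‖) :
    19 * (‖μ - x‖ - ρ) ^ 2 ≤ 18 * r ^ 2 := by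
  set D := ‖μ - x‖ with hDdef
  have hDpos : 0 < D := hρ.trans_le hD
  -- Weight q² on 19k/20 bins gives exactly 0.9k.
  set q := Real.sqrt (18 / 19) with hq
  have hq2 : q ^ 2 = 18 / 19 := Real.sq_sqrt (by norm_num)
  have hq0 : 0 < q := Real.sqrt_pos.2 (by norm_num)
  have hq1 : q ≤ 1 := Real.sqrt_le_one.2 (by norm_num)
  set u : Vec d := D⁻¹ • (μ - x) with hu
  have hu1 : ‖u‖ = 1 := by
    rw [hu, norm_smul, norm_inv, Real.norm_of_nonneg hDpos.le, ← hDdef, inv_mul_cancel₀ hDpos.ne']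
  have huw : inner ℝ u (μ - x) = D := by
    rw [hu, inner_smul_left, real_inner_self_eq_norm_sq, ← hDdef, RCLike.conj_to_real]
    field_simp
  let S : Finset (Fin k) := Finset.univ.filter fun i => -ρ < inner ℝ u (Z i - μ)
  have hS := card_near_ge hC (u := -u) (by simpa using hu1) S fun i hi => by
    rw [inner_neg_left] at hi
    simp only [S, Finset.mem_filter, Finset.mem_univ, true_and]
    linarith
  obtain ⟨X, hX, hm⟩ := exists_feasible_of_direction x ((D - ρ) / q) Z hu1 hq0.le hq1 S
    fun i hi => by
      simp only [S, Finset.mem_filter, Finset.mem_univ, true_and] at hi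
      have : Z i - x = (Z i - μ) + (μ - x) := by abel
      rw [this, inner_add_right, huw, mul_div_cancel₀ _ hq0.ne']
      linarith
  have hle : (D - ρ) / q ≤ r := by
    refine hr.2 ⟨div_nonneg (by linarith) hq0.le, (qualifies_iff _ _ _).2 ⟨X, hX, ?_⟩⟩
    rw [hm, hq2]
    linarith
  rw [div_le_iff₀ hq0] at hle
  have h1 : (D - ρ) ^ 2 ≤ (r * q) ^ 2 := pow_le_pow_left₀ (by linarith) hle 2
  rw [mul_pow, hq2] at h1
  linarith

/-- A bin with α ≤ p_i (r - ρ)² has ⟨v_b, μ - x⟩ ≤ p_i (r - ρ) by Cauchy–Schwarz, so it stays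
separated by ρ when the centre moves from x to μ. Such bins have total weight at most k/20; for the
others, p_i (r - ρ)² < α bounds the weight. -/
theorem quadV_lower (hC : ∀ Y, MTFeasible μ ρ Z Y → mtObjective Y ≤ k / 20)
    (hX : MTFeasible x r Z X) (hobj : (9 / 10 : ℝ) * k ≤ mtObjective X) (hk : 0 < k)
    (hr : ρ < r) : 17 * (r - ρ) ^ 2 ≤ 19 * quadV X (μ - x) := by
  classical
  set α := quadV X (μ - x) with hα
  set e := (r - ρ) ^ 2 with he
  have hα0 : 0 ≤ α := quadV_nonneg hX.psd _
  have he0 : 0 < e := pow_pos (by linarith) 2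
  let p : Fin k → ℝ := fun i => X (Idx.b i) (Idx.b i)
  have hp0 : ∀ i, 0 ≤ p i := hX.diag_b_nonneg
  have hp1 : ∀ i, p i ≤ 1 := hX.diag_b_le_one
  let S : Finset (Fin k) := Finset.univ.filter fun i => α ≤ p i * e
  have hS : ∑ i ∈ S, p i ≤ k / 20 := by
    refine hX.sum_le_of_subset hC S fun i hi => ?_
    simp only [S, Finset.mem_filter, Finset.mem_univ, true_and] at hi
    have h1 : Z i - μ = (Z i - x) - (μ - x) := by abel
    have h2 := hX.sep i
    have h3 := inner_vb_sq_le hX.psd i (μ - x)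
    have h4 : inner ℝ (vb X i) (μ - x) ≤ p i * (r - ρ) := by
      refine (le_abs_self _).trans (abs_le_of_sq_le_sq ?_ (mul_nonneg (hp0 i) (by linarith)))
      calc _ ≤ p i * α := h3
        _ ≤ p i * (p i * e) := mul_le_mul_of_nonneg_left hi (hp0 i)
        _ = _ := by rw [he]; ring
    rw [h1, inner_sub_right]
    change p i * r ≤ _ at h2
    change p i * ρ ≤ _
    linarith
  have hsum : (9 / 10 : ℝ) * k ≤ ∑ i ∈ S, p i + ∑ i ∈ Sᶜ, p i := by
    rw [Finset.sum_add_sum_compl, ← hX.objective_eq]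
    exact hobj
  have hScard : ∑ i ∈ S, p i ≤ S.card := by
    simpa using Finset.sum_le_card_nsmul S p 1 fun i _ => hp1 i
  have hSc : (∑ i ∈ Sᶜ, p i) * e ≤ Sᶜ.card * α := by
    rw [Finset.sum_mul]
    have := Finset.sum_le_card_nsmul Sᶜ (fun i => p i * e) α fun i hi => by
      simp only [S, Finset.mem_compl, Finset.mem_filter, Finset.mem_univ, true_and, not_le] at hi
      exact hi.le
    simpa using this
  have hcard : (S.card : ℝ) + Sᶜ.card = k := by
    have := S.card_add_card_compl
    rw [Fintype.card_fin] at this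
    exact_mod_cast this
  have hk' : (0 : ℝ) < k := by exact_mod_cast hk
  -- Let κ be the weight of S. As |Sᶜ| ≤ k - κ, the objective bound gives 0.9k e ≤ κe + (k - κ)α.
  -- For α < e the right side increases in κ, and κ = k/20 yields 17e ≤ 19α.
  by_contra! hcon
  have hαe : α < e := by nlinarith
  set κ := ∑ i ∈ S, p i
  have h1 : (Sᶜ.card : ℝ) * α ≤ (k - κ) * α := mul_le_mul_of_nonneg_right (by linarith) hα0
  have h2 : (9 / 10 : ℝ) * k * e ≤ κ * e + (k - κ) * α := by nlinarith
  have h3 : κ * (e - α) ≤ k / 20 * (e - α) := mul_le_mul_of_nonneg_right hS (by linarith)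
  nlinarith

theorem distanceEstimation_upper (hC : ∀ Y, MTFeasible μ ρ Z Y → mtObjective Y ≤ k / 20)
    (hr : DistanceEstimation Z x r) (hk : 0 < k) (hrρ : ρ < r) :
    17 * (r - ρ) ^ 2 ≤ 19 * ‖μ - x‖ ^ 2 := by
  obtain ⟨X, hX, hobj⟩ := (qualifies_iff _ _ _).1 hr.1.2
  have := quadV_lower hC hX hobj hk hrρ
  linarith [hX.quadV_le (μ - x)]

/-- The gradient estimate correlates with the direction of the mean. -/
theorem gradientEstimation_inner (hC : ∀ Y, MTFeasible μ ρ Z Y → mtObjective Y ≤ k / 20)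
    (hr : DistanceEstimation Z x r) (hk : 0 < k) (hρ : 0 < ρ) (hD : 120 * ρ ≤ ‖μ - x‖)
    (hlow : 1.0188 * ‖μ - x‖ ≤ r) {g : Vec d} (hg : GradientEstimation Z x g) :
    ‖g‖ = 1 ∧ 0.949 * ‖μ - x‖ ≤ inner ℝ g (μ - x) := by
  classical
  obtain ⟨r', X, m, y, hr', hX, hy, hgy⟩ := hg
  obtain rfl : r = r' := hr.unique hr'
  set D := ‖μ - x‖ with hDdef
  have hDpos : 0 < D := by linarith
  have hobj : (9 / 10 : ℝ) * k ≤ mtObjective X := by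
    obtain ⟨Y, hY, hYo⟩ := (qualifies_iff _ _ _).1 hr.1.2
    rw [hX.2.1]
    exact hYo.trans (hX.2.2 Y hY)
  have hα := quadV_lower hC hX.1 hobj hk (by linarith)
  obtain ⟨h1, h2⟩ := hX.1.quadV_le_of_top hy (μ - x)
  set α := quadV X (μ - x)
  set N := specNorm (subV X)
  set s := inner ℝ y (μ - x) with hs
  rw [← hDdef] at h1 h2
  -- Here 1.0104 comes from 1.0188 - 1/120, and (17/19) · 1.0104² > 0.91.
  have hα2 : 0.91 * D ^ 2 ≤ α := by
    have h3 : 1.0104 * D ≤ r - ρ := by linarith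
    have h4 : (1.0104 * D) ^ 2 ≤ (r - ρ) ^ 2 := pow_le_pow_left₀ (by positivity) h3 2
    nlinarith
  have hD2 : 0 < D ^ 2 := by positivity
  have hN : 0.91 ≤ N := by
    by_contra! h
    nlinarith
  -- From 0.91 D² ≤ N s² + (1 - N) D² follows s² ≥ (1 - 0.09/N) D², and 1 - 0.09/0.91 > 0.949².
  have hs2 : (0.949 * D) ^ 2 ≤ s ^ 2 := by
    have h3 : (N - 0.09) * D ^ 2 ≤ N * s ^ 2 := by nlinarith
    by_contra! h
    have h4 : N * s ^ 2 ≤ N * (0.949 * D) ^ 2 := mul_le_mul_of_nonneg_left h.le (by linarith)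
    nlinarith
  have habs : 0.949 * D ≤ |s| := le_of_sq_le_sq (by rwa [sq_abs]) (abs_nonneg s)
  have hk' : (0 : ℝ) < k := by exact_mod_cast hk
  have hdec : ∀ i, inner ℝ (Z i - x) y = inner ℝ y (Z i - μ) + s := fun i => by
    rw [hs, ← inner_add_right, real_inner_comm]
    congr 1
    abel
  -- Since |s| > ρ, at least 19k/20 bins see the sign of s, which clears the threshold 0.9k on the
  -- correct side in both cases.
  rcases le_total 0 s with h0 | h0
  · rw [abs_of_nonneg h0] at habs
    have hcard := card_near_ge hC (u := -y) (by simpa using hy.1)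
      (Finset.univ.filter fun i : Fin k => 0 ≤ inner ℝ (Z i - x) y) fun i hi => by
        rw [inner_neg_left] at hi
        simp only [Finset.mem_filter, Finset.mem_univ, true_and, hdec]
        linarith
    rw [if_pos (by linarith)] at hgy
    rw [hgy]
    exact ⟨hy.1, habs⟩
  · rw [abs_of_nonpos h0] at habs
    have hcard := card_far_le hC hy.1
      (Finset.univ.filter fun i : Fin k => 0 ≤ inner ℝ (Z i - x) y) fun i hi => by
        simp only [Finset.mem_filter, Finset.mem_univ, true_and, hdec] at hi
        linarith
    rw [if_neg (by linarith)] at hgy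
    rw [hgy, inner_neg_left, norm_neg]
    exact ⟨hy.1, habs⟩

/-- One step of the descent. -/
theorem descent_step (hC : ∀ Y, MTFeasible μ ρ Z Y → mtObjective Y ≤ k / 20)
    (hk : 0 < k) (hρ : 0 < ρ) (hD : 120 * ρ ≤ ‖μ - x‖) (hr : DistanceEstimation Z x r)
    {g : Vec d} (hg : GradientEstimation Z x g) :
    ‖μ - (x + (1 / 20 * r) • g)‖ ≤ 0.952 * ‖μ - x‖ ∧
    ∀ r', DistanceEstimation Z (x + (1 / 20 * r) • g) r' → r' < r := by
  have hDpos : 0 < ‖μ - x‖ := by linarith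
  have hr0 : 0 ≤ r := hr.1.1
  -- The constants are 0.99166 < 1 - 1/120 and 1.0188 < √(19/18) · 0.99166.
  have hlow : 1.0188 * ‖μ - x‖ ≤ r := by
    have h1 := distanceEstimation_lower hC hr hρ (by linarith)
    have h2 : 0.99166 * ‖μ - x‖ ≤ ‖μ - x‖ - ρ := by linarith
    have h3 : (0.99166 * ‖μ - x‖) ^ 2 ≤ (‖μ - x‖ - ρ) ^ 2 := pow_le_pow_left₀ (by positivity) h2 2
    refine le_of_sq_le_sq ?_ hr0
    nlinarith
  have hup : r ≤ 1.0666 * ‖μ - x‖ := by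
    have h1 := distanceEstimation_upper hC hr hk (by linarith)
    have h2 : r - ρ ≤ 1.0572 * ‖μ - x‖ := by
      refine le_of_sq_le_sq ?_ (by positivity)
      nlinarith [sq_nonneg ‖μ - x‖]
    linarith
  obtain ⟨hg1, hgi⟩ := gradientEstimation_inner hC hr hk hρ hD hlow hg
  set D := ‖μ - x‖ with hDdef
  -- With c = r/D in [1.0188, 1.0666], the squared ratio is at most 1 - 0.0949c + c²/400, which is
  -- below 0.952².
  have hnew : ‖μ - (x + (1 / 20 * r) • g)‖ ≤ 0.952 * D := by
    refine le_of_sq_le_sq ?_ (by positivity)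
    have : μ - (x + (1 / 20 * r) • g) = (μ - x) - (1 / 20 * r) • g := by abel
    rw [this, norm_sub_sq_real, ← hDdef, inner_smul_right, norm_smul, hg1, mul_one,
      Real.norm_eq_abs, sq_abs, real_inner_comm]
    have h1 : r * (0.949 * D) ≤ r * inner ℝ g (μ - x) := mul_le_mul_of_nonneg_left hgi hr0
    nlinarith
  refine ⟨hnew, fun r' hr' => ?_⟩
  -- The contraction must beat the gap between the two bounds on the estimate: 19 · 0.952² < 17 ·
  -- 1.0104².
  by_contra! hcon
  have h1 := distanceEstimation_upper hC hr' hk (by linarith)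
  have h2 : ‖μ - (x + (1 / 20 * r) • g)‖ ^ 2 ≤ (0.952 * D) ^ 2 :=
    pow_le_pow_left₀ (norm_nonneg _) hnew 2
  have h3 : (1.0104 * D) ^ 2 ≤ (r' - ρ) ^ 2 := pow_le_pow_left₀ (by positivity) (by linarith) 2
  nlinarith

/-- The distance of the best iterate from the mean. -/
theorem loopReaches_invariant (hC : ∀ Y, MTFeasible μ ρ Z Y → mtObjective Y ≤ k / 20)
    (hk : 0 < k) (hρ : 0 < ρ) {t : ℕ} {s : LoopState d}
    (hs : LoopReaches DistanceEstimation GradientEstimation Z (1 / 20) (t + 1) s) :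
    ∃ r : ℝ, s.bestDist = r ∧ DistanceEstimation Z s.best r ∧
      (r ≤ 128 * ρ ∨ ‖μ - s.best‖ ≤ 0.952 ^ t * ‖μ‖ ∧ ‖μ - s.cur‖ ≤ 0.952 ^ (t + 1) * ‖μ‖ ∧
        ∀ r', DistanceEstimation Z s.cur r' → r' < r) := by
  -- Far from μ the descent step applies. Within 120ρ the upper bound gives r - ρ < 127ρ, because
  -- √(19/17) · 120 < 127.
  have key : ∀ (x : Vec d) (r : ℝ) (g : Vec d) (t : ℕ), DistanceEstimation Z x r →
      GradientEstimation Z x g → ‖μ - x‖ ≤ 0.952 ^ t * ‖μ‖ →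
      r ≤ 128 * ρ ∨ ‖μ - x‖ ≤ 0.952 ^ t * ‖μ‖ ∧
        ‖μ - (x + (1 / 20 * r) • g)‖ ≤ 0.952 ^ (t + 1) * ‖μ‖ ∧
        ∀ r', DistanceEstimation Z (x + (1 / 20 * r) • g) r' → r' < r := by
    intro x r g t hr hg hx
    rcases le_total (120 * ρ) ‖μ - x‖ with h | h
    · obtain ⟨h1, h2⟩ := descent_step hC hk hρ h hr hg
      refine .inr ⟨hx, h1.trans ?_, h2⟩
      rw [pow_succ]
      linarith
    · refine .inl ?_
      by_contra! hcon
      have h1 := distanceEstimation_upper hC hr hk (by linarith)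
      have h2 : ‖μ - x‖ ^ 2 ≤ (120 * ρ) ^ 2 := pow_le_pow_left₀ (norm_nonneg _) h 2
      have h3 : (127 * ρ) ^ 2 ≤ (r - ρ) ^ 2 := pow_le_pow_left₀ (by positivity) (by linarith) 2
      nlinarith
  induction t generalizing s with
  | zero =>
    cases hs with
    | @step _ _ r g hs hr hg =>
      cases hs
      refine ⟨r, by simp, by simpa using hr, ?_⟩
      simpa using key 0 r g 0 hr hg (by simp)
  | succ t ih =>
    cases hs with
    | @step _ s r' g hs hr hg =>
      obtain ⟨r, hbd, hbest, hor⟩ := ih hs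
      by_cases hlt : (r' : WithTop ℝ) < s.bestDist
      · simp only [if_pos hlt]
        refine ⟨r', rfl, hr, ?_⟩
        rcases hor with h | ⟨h1, h2, h3⟩
        · left
          rw [hbd, WithTop.coe_lt_coe] at hlt
          linarith
        · exact key _ _ _ _ hr hg h2
      · simp only [if_neg hlt]
        refine ⟨r, hbd, hbest, ?_⟩
        rcases hor with h | ⟨h1, h2, h3⟩
        · exact .inl h
        -- As long as no estimate has dropped to 128ρ, every pass improves the record.
        · exact absurd (by rw [hbd, WithTop.coe_lt_coe]; exact h3 _ hr) hlt

theorem norm_best_sub_le (hC : ∀ Y, MTFeasible μ ρ Z Y → mtObjective Y ≤ k / 20)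
    (hk : 0 < k) (hρ : 0 < ρ) {ε : ℝ} (hε : 0 < ε) {s : LoopState d}
    (hs : LoopReaches DistanceEstimation GradientEstimation Z (1 / 20)
      (⌈1000 * Real.log (‖μ‖ / ε)⌉₊ + 1) s) :
    ‖s.best - μ‖ ≤ max ε (128 * ρ) := by
  obtain ⟨r, -, hr, h | ⟨h, -⟩⟩ := loopReaches_invariant hC hk hρ hs
  · refine le_max_of_le_right ?_
    rw [norm_sub_rev]
    -- If D > 128ρ, then D - ρ > 127ρ, against r ≤ 128ρ and 19 · 127² > 18 · 128².
    by_contra! hcon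
    have h1 := distanceEstimation_lower hC hr hρ (by linarith)
    have h2 : r ^ 2 ≤ (128 * ρ) ^ 2 := pow_le_pow_left₀ hr.1.1 h 2
    have h3 : (127 * ρ) ^ 2 ≤ (‖μ - s.best‖ - ρ) ^ 2 :=
      pow_le_pow_left₀ (by positivity) (by linarith) 2
    nlinarith
  · refine le_max_of_le_left ?_
    rw [norm_sub_rev]
    refine h.trans ?_
    set T := ⌈1000 * Real.log (‖μ‖ / ε)⌉₊ with hT
    have hTle : 1000 * Real.log (‖μ‖ / ε) ≤ T := Nat.le_ceil _
    rcases (norm_nonneg μ).eq_or_lt with h0 | h0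
    · rw [← h0, mul_zero]
      exact hε.le
    · have h1 : (0.952 : ℝ) ^ T ≤ Real.exp (-(T / 1000)) := by
        have h2 : (0.952 : ℝ) ≤ Real.exp (-(1 / 1000)) := by
          have := Real.add_one_le_exp (-(1 / 1000) : ℝ)
          linarith
        calc (0.952 : ℝ) ^ T ≤ Real.exp (-(1 / 1000)) ^ T := pow_le_pow_left₀ (by norm_num) h2 T
          _ = _ := by
            rw [← Real.exp_nat_mul]
            congr 1
            ring
      have h3 : Real.exp (-(T / 1000)) ≤ (‖μ‖ / ε)⁻¹ := by
        rw [← Real.exp_log (by positivity : 0 < (‖μ‖ / ε)⁻¹), Real.log_inv]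
        exact Real.exp_le_exp.2 (by linarith)
      calc _ ≤ (‖μ‖ / ε)⁻¹ * ‖μ‖ := mul_le_mul_of_nonneg_right (h1.trans h3) h0.le
        _ = ε := by field_simp

end Descent

/-! ### The bounded differences inequality -/

section BoundedDifferences

variable {E : Type*} [MeasurableSpace E]

theorem measurePreserving_cons {k : ℕ} (ν : Fin (k + 1) → Measure E)
    [∀ i, IsProbabilityMeasure (ν i)] :
    MeasurePreserving (fun p : E × (Fin k → E) => (Fin.cons p.1 p.2 : Fin (k + 1) → E))
      ((ν 0).prod (Measure.pi fun j => ν j.succ)) (Measure.pi ν) := by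
  have h := (measurePreserving_piFinSuccAbove ν 0).symm
  simp only [Fin.succAbove_zero] at h
  convert h using 1
  ext p i
  refine Fin.cases ?_ (fun j => ?_) i <;>
    simp [MeasurableEquiv.piFinSuccAbove, Fin.insertNthEquiv]

theorem integral_pi_succ {k : ℕ} (ν : Fin (k + 1) → Measure E)
    [∀ i, IsProbabilityMeasure (ν i)] {f : (Fin (k + 1) → E) → ℝ}
    (hf : AEStronglyMeasurable f (Measure.pi ν)) :
    ∫ y, f y ∂Measure.pi ν =
      ∫ p, f (Fin.cons p.1 p.2) ∂((ν 0).prod (Measure.pi fun j => ν j.succ)) := by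
  have h := measurePreserving_cons ν
  rw [← h.map_eq, integral_map h.measurable.aemeasurable (h.map_eq.symm ▸ hf)]

/-- Hoeffding's lemma: oscillation at most 1 places f in an interval of length 1 starting at its
infimum. -/
theorem integral_exp_le_of_diff_le_one (ν : Measure E) [IsProbabilityMeasure ν] {f : E → ℝ}
    (hf : Measurable f) {C : ℝ} (hC : ∀ y, |f y| ≤ C) (hd : ∀ y z, f y - f z ≤ 1) (c : ℝ) :
    ∫ y, Real.exp (c * (f y - ∫ z, f z ∂ν)) ∂ν ≤ Real.exp (c ^ 2 / 8) := by
  have : Nonempty E := nonempty_of_isProbabilityMeasure ν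
  have hbdd : BddBelow (Set.range f) := ⟨-C, by rintro _ ⟨y, rfl⟩; exact (abs_le.1 (hC y)).1⟩
  have h := (hasSubgaussianMGF_of_mem_Icc (μ := ν) (a := ⨅ y, f y) (b := (⨅ y, f y) + 1)
    hf.aemeasurable (Filter.Eventually.of_forall fun y => ⟨ciInf_le hbdd y, by
      have := le_ciInf fun z => (by linarith [hd y z] : f y - 1 ≤ f z)
      linarith⟩)).mgf_le c
  refine h.trans_eq ?_
  congr 1
  simp
  ring

/-- Induction on the number of coordinates. Averaging over the first coordinate preserves the
bounded differences in the rest, and the fluctuation in the first coordinate costs one factor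
exp(c²/8). -/
theorem integral_exp_le_of_bounded_differences {k : ℕ} (ν : Fin k → Measure E)
    [∀ i, IsProbabilityMeasure (ν i)] {f : (Fin k → E) → ℝ} (hf : Measurable f) {C : ℝ}
    (hC : ∀ y, |f y| ≤ C) (hd : ∀ i y z, f (Function.update y i z) - f y ≤ 1) (c : ℝ) :
    ∫ y, Real.exp (c * (f y - ∫ z, f z ∂Measure.pi ν)) ∂Measure.pi ν ≤
      Real.exp (k * (c ^ 2 / 8)) := by
  induction k with
  | zero =>
    rw [Measure.pi_of_empty ν default]
    simp
  | succ k ih =>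
    set ν' : Fin k → Measure E := fun j => ν j.succ with hν'
    have hcons : Measurable fun p : E × (Fin k → E) => (Fin.cons p.1 p.2 : Fin (k + 1) → E) :=
      (measurePreserving_cons ν).measurable
    set F : E × (Fin k → E) → ℝ := fun p => f (Fin.cons p.1 p.2) with hF
    have hFm : Measurable F := hf.comp hcons
    have hFC : ∀ p, |F p| ≤ C := fun p => hC _
    have hC0 : 0 ≤ C := by
      obtain ⟨y⟩ : Nonempty (Fin (k + 1) → E) := nonempty_of_isProbabilityMeasure (Measure.pi ν)
      exact (abs_nonneg _).trans (hC y)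
    have hFi : Integrable F ((ν 0).prod (Measure.pi ν')) :=
      Integrable.of_bound hFm.aestronglyMeasurable C (Filter.Eventually.of_forall hFC)
    set m := ∫ z, f z ∂Measure.pi ν with hm
    have hmF : m = ∫ p, F p ∂(ν 0).prod (Measure.pi ν') :=
      integral_pi_succ ν hf.aestronglyMeasurable
    set g : (Fin k → E) → ℝ := fun y => ∫ z, F (z, y) ∂ν 0 with hg
    have hgm : Measurable g :=
      (hFm.stronglyMeasurable.integral_prod_left' (μ := ν 0)).measurable
    have hgC : ∀ y, |g y| ≤ C := fun y => by
      have := norm_integral_le_of_norm_le_const (μ := ν 0) (f := fun z => F (z, y)) (C := C)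
        (Filter.Eventually.of_forall fun z => hFC _)
      simpa using this
    have hFyi : ∀ y, Integrable (fun z => F (z, y)) (ν 0) := fun y =>
      Integrable.of_bound (hFm.comp measurable_prodMk_right).aestronglyMeasurable C
        (Filter.Eventually.of_forall fun z => hFC _)
    have hmg : m = ∫ y, g y ∂Measure.pi ν' := by
      rw [hmF, integral_prod_symm _ hFi]
    have hgd : ∀ i y z, g (Function.update y i z) - g y ≤ 1 := fun i y z => by
      rw [hg]
      simp only
      rw [← integral_sub (hFyi _) (hFyi _)]
      calc _ ≤ ∫ _, (1 : ℝ) ∂ν 0 := by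
            refine integral_mono ((hFyi _).sub (hFyi _)) (integrable_const _) fun w => ?_
            have h := Fin.cons_update (α := fun _ => E) w y i z
            simp only [hF, h]
            exact hd _ _ _
        _ = 1 := by simp
    have hih := ih ν' hgm hgC hgd
    rw [← hmg] at hih
    have hexpm : Measurable fun p => Real.exp (c * (F p - m)) := by fun_prop
    have habs : ∀ t : ℝ, |t| ≤ C → Real.exp (c * (t - m)) ≤ Real.exp (|c| * (C + |m|)) := by
      intro t ht
      refine Real.exp_le_exp.2 ((le_abs_self _).trans ?_)
      rw [abs_mul]
      exact mul_le_mul_of_nonneg_left ((abs_sub _ _).trans (by linarith)) (abs_nonneg _)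
    have hexpi : Integrable (fun p => Real.exp (c * (F p - m))) ((ν 0).prod (Measure.pi ν')) :=
      Integrable.of_bound hexpm.aestronglyMeasurable _ (Filter.Eventually.of_forall fun p => by
        rw [Real.norm_of_nonneg (Real.exp_pos _).le]
        exact habs _ (hFC p))
    have hexpg : Integrable (fun y => Real.exp (c * (g y - m))) (Measure.pi ν') :=
      Integrable.of_bound (by fun_prop) _ (Filter.Eventually.of_forall fun y => by
        rw [Real.norm_of_nonneg (Real.exp_pos _).le]
        exact habs _ (hgC y))
    rw [integral_pi_succ ν (by fun_prop), integral_prod_symm _ hexpi]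
    calc ∫ y, ∫ z, Real.exp (c * (F (z, y) - m)) ∂ν 0 ∂Measure.pi ν'
        ≤ ∫ y, Real.exp (c ^ 2 / 8) * Real.exp (c * (g y - m)) ∂Measure.pi ν' := by
          refine integral_mono hexpi.integral_prod_right (hexpg.const_mul _) fun y => ?_
          have h1 := integral_exp_le_of_diff_le_one (ν 0) (f := fun z => F (z, y))
            (hFm.comp measurable_prodMk_right) (fun z => hFC _) (fun z w => by
              have := hd 0 (Fin.cons w y) z
              rwa [Fin.update_cons_zero] at this) c
          have h2 : ∀ z, Real.exp (c * (F (z, y) - m)) =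
              Real.exp (c * (F (z, y) - g y)) * Real.exp (c * (g y - m)) := fun z => by
            rw [← Real.exp_add]
            ring_nf
          simp only [h2]
          rw [integral_mul_const]
          exact mul_le_mul_of_nonneg_right h1 (Real.exp_pos _).le
      _ ≤ Real.exp (c ^ 2 / 8) * Real.exp (k * (c ^ 2 / 8)) := by
          rw [integral_const_mul]
          exact mul_le_mul_of_nonneg_left hih (Real.exp_pos _).le
      _ = _ := by
          rw [← Real.exp_add]
          push_cast
          ring_nf

/-- McDiarmid's inequality for functions with bounded differences `1`. -/
theorem measureReal_ge_le_of_bounded_differences {k : ℕ} (ν : Fin k → Measure E)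
    [∀ i, IsProbabilityMeasure (ν i)] {f : (Fin k → E) → ℝ} (hf : Measurable f) {C : ℝ}
    (hC : ∀ y, |f y| ≤ C) (hd : ∀ i y z, f (Function.update y i z) - f y ≤ 1) {τ : ℝ}
    (hτ : 0 ≤ τ) :
    (Measure.pi ν).real {y | k * τ ≤ f y - ∫ z, f z ∂Measure.pi ν} ≤
      Real.exp (-(2 * τ ^ 2 * k)) := by
  set m := ∫ z, f z ∂Measure.pi ν
  -- The Chernoff parameter c = 4τ minimizes -cτk + kc²/8.
  have hint : Integrable (fun y => Real.exp (4 * τ * (f y - m))) (Measure.pi ν) := by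
    refine Integrable.of_bound (by fun_prop) (Real.exp (4 * τ * (C + |m|)))
      (Filter.Eventually.of_forall fun y => ?_)
    rw [Real.norm_of_nonneg (Real.exp_pos _).le]
    refine Real.exp_le_exp.2 (mul_le_mul_of_nonneg_left ?_ (by positivity))
    linarith [le_abs_self (f y), hC y, neg_abs_le m]
  refine (measure_ge_le_exp_mul_mgf _ (by positivity) hint).trans ?_
  refine (mul_le_mul_of_nonneg_left
    (integral_exp_le_of_bounded_differences ν hf hC hd (4 * τ)) (Real.exp_pos _).le).trans_eq ?_
  rw [← Real.exp_add]
  ring_nf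

end BoundedDifferences

/-! ### Averages over signs -/

section SignAverage

variable {E : Type*} [NormedAddCommGroup E]

/-- The average of `f (a ± v₁ ± ⋯ ± vₘ)` over all choices of signs. -/
def signAvg : List E → (E → ℝ) → E → ℝ
  | [], f, a => f a
  | v :: l, f, a => (signAvg l f (a + v) + signAvg l f (a - v)) / 2

theorem signAvg_mono (l : List E) {f g : E → ℝ} (h : ∀ u, f u ≤ g u) (a : E) :
    signAvg l f a ≤ signAvg l g a := by
  induction l generalizing a with
  | nil => exact h a
  | cons v l ih => simp only [signAvg]; linarith [ih (a + v), ih (a - v)]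

theorem signAvg_add (l : List E) (f g : E → ℝ) (a : E) :
    signAvg l (fun u => f u + g u) a = signAvg l f a + signAvg l g a := by
  induction l generalizing a with
  | nil => rfl
  | cons v l ih => simp only [signAvg, ih]; ring

theorem signAvg_const_mul (l : List E) (c : ℝ) (f : E → ℝ) (a : E) :
    signAvg l (fun u => c * f u) a = c * signAvg l f a := by
  induction l generalizing a with
  | nil => rfl
  | cons v l ih => simp only [signAvg, ih]; ring

theorem signAvg_const (l : List E) (c : ℝ) (a : E) : signAvg l (fun _ => c) a = c := by
  induction l generalizing a with
  | nil => rfl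
  | cons v l ih => simp only [signAvg, ih]; ring

theorem signAvg_sum {ι : Type*} (s : Finset ι) (l : List E) (f : ι → E → ℝ) (a : E) :
    signAvg l (fun u => ∑ i ∈ s, f i u) a = ∑ i ∈ s, signAvg l (f i) a := by
  induction l generalizing a with
  | nil => rfl
  | cons v l ih => simp only [signAvg, ih, ← Finset.sum_add_distrib, Finset.sum_div]

variable [InnerProductSpace ℝ E]

theorem signAvg_norm_sq (l : List E) (a : E) :
    signAvg l (fun u => ‖u‖ ^ 2) a = ‖a‖ ^ 2 + (l.map fun v => ‖v‖ ^ 2).sum := by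
  induction l generalizing a with
  | nil => simp [signAvg]
  | cons v l ih =>
    simp only [signAvg, ih, List.map_cons, List.sum_cons, norm_add_sq_real, norm_sub_sq_real]
    ring

theorem signAvg_inner_sq (l : List E) (y a : E) :
    signAvg l (fun u => inner ℝ u y ^ 2) a =
      inner ℝ a y ^ 2 + (l.map fun v => inner ℝ v y ^ 2).sum := by
  induction l generalizing a with
  | nil => simp [signAvg]
  | cons v l ih =>
    simp only [signAvg, ih, List.map_cons, List.sum_cons, inner_add_left, inner_sub_left]
    ring

/-- In the expansion odd powers of the signs cancel. The general base point `a` is what makes the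
induction close; at a = 0 this is the fourth moment bound 3σ⁴. -/
theorem signAvg_inner_pow_four_le (l : List E) (y a : E) :
    signAvg l (fun u => inner ℝ u y ^ 4) a ≤
      inner ℝ a y ^ 4 + 6 * inner ℝ a y ^ 2 * (l.map fun v => inner ℝ v y ^ 2).sum +
        3 * (l.map fun v => inner ℝ v y ^ 2).sum ^ 2 := by
  induction l generalizing a with
  | nil => simp [signAvg]
  | cons v l ih =>
    have h1 := ih (a + v)
    have h2 := ih (a - v)
    simp only [signAvg, List.map_cons, List.sum_cons]
    simp only [inner_add_left, inner_sub_left] at h1 h2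
    nlinarith [sq_nonneg (inner ℝ v y ^ 2 : ℝ)]

/-- A Khintchine inequality. -/
theorem le_signAvg_abs_inner (l : List E) (y : E) :
    4 / 7 * Real.sqrt (l.map fun v => inner ℝ v y ^ 2).sum ≤
      signAvg l (fun u => |inner ℝ u y|) 0 := by
  have hS0 : 0 ≤ (l.map fun v => (inner ℝ v y : ℝ) ^ 2).sum := by
    refine List.sum_nonneg fun t ht => ?_
    obtain ⟨v, -, rfl⟩ := List.mem_map.1 ht
    positivity
  set σ := Real.sqrt (l.map fun v => (inner ℝ v y : ℝ) ^ 2).sum with hσ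
  have hσ2 : σ ^ 2 = (l.map fun v => (inner ℝ v y : ℝ) ^ 2).sum := Real.sq_sqrt hS0
  rcases (Real.sqrt_nonneg (l.map fun v => (inner ℝ v y : ℝ) ^ 2).sum).eq_or_lt with h0 | h0
  · rw [hσ, ← h0, mul_zero, ← signAvg_const l 0 0]
    exact signAvg_mono l (fun u => abs_nonneg _) 0
  rw [← hσ] at h0
  have h2 := signAvg_inner_sq l y 0
  have h4 := signAvg_inner_pow_four_le l y 0
  rw [← hσ2] at h2 h4
  simp only [inner_zero_left] at h2 h4
  -- For t ≥ 0 one has t ≥ (7/8)t² - t⁴/10, nearly tangent at t = 1.7. With second moment 1 and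
  -- fourth moment at most 3 the average is at least 7/8 - 3/10 > 4/7.
  have hpt : ∀ u : E, 7 / 8 / σ * inner ℝ u y ^ 2 + -(1 / 10 / σ ^ 3) * inner ℝ u y ^ 4 ≤
      |inner ℝ u y| := by
    intro u
    set t := |(inner ℝ u y : ℝ)| / σ with ht
    have ht0 : 0 ≤ t := by positivity
    have hu : |(inner ℝ u y : ℝ)| = t * σ := by rw [ht]; field_simp
    have e2 : (inner ℝ u y : ℝ) ^ 2 = (t * σ) ^ 2 := by rw [← hu, sq_abs]
    have e4 : (inner ℝ u y : ℝ) ^ 4 = (t * σ) ^ 4 := by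
      rw [show 4 = 2 * 2 by norm_num, pow_mul, e2]; ring
    rw [e2, e4, hu]
    have : 7 / 8 / σ * (t * σ) ^ 2 + -(1 / 10 / σ ^ 3) * (t * σ) ^ 4 =
        (7 / 8 * t ^ 2 - 1 / 10 * t ^ 4) * σ := by field_simp; ring
    rw [this]
    refine mul_le_mul_of_nonneg_right ?_ h0.le
    have h3 : 0 ≤ 1 - 7 / 8 * t + 1 / 10 * t ^ 3 := by
      nlinarith [mul_nonneg ht0 (sq_nonneg (t - 1.7)), sq_nonneg (t - 1.7)]
    nlinarith
  have h := signAvg_mono l hpt 0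
  rw [signAvg_add, signAvg_const_mul, signAvg_const_mul, h2] at h
  refine le_trans ?_ h
  have h5 : 1 / 10 / σ ^ 3 * signAvg l (fun u => (inner ℝ u y : ℝ) ^ 4) 0 ≤ 3 / 10 * σ := by
    calc _ ≤ 1 / 10 / σ ^ 3 * (3 * (σ ^ 2) ^ 2) := by
          refine mul_le_mul_of_nonneg_left ?_ (by positivity)
          simpa using h4
      _ = _ := by field_simp
  have h6 : 7 / 8 / σ * (0 ^ 2 + σ ^ 2) = 7 / 8 * σ := by field_simp; ring
  rw [h6]
  linarith

end SignAverage

/-! ### Suprema of Lipschitz families -/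

section LipschitzFamily

variable {ι M : Type*} [NormedAddCommGroup M] {G : ι → M → ℝ} {K C : ℝ}

theorem lipFamily_le (hL : ∀ u z z', G u z ≤ G u z' + K * ‖z - z'‖) (h0 : ∀ u, |G u 0| ≤ C)
    (u : ι) (z : M) : |G u z| ≤ C + K * ‖z‖ := by
  have h1 := hL u z 0
  have h2 := hL u 0 z
  have h3 := abs_le.1 (h0 u)
  rw [sub_zero] at h1
  rw [zero_sub, norm_neg] at h2
  exact abs_le.2 ⟨by linarith, by linarith⟩

theorem lipFamily_bddAbove (hL : ∀ u z z', G u z ≤ G u z' + K * ‖z - z'‖)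
    (h0 : ∀ u, |G u 0| ≤ C) (z : M) : BddAbove (Set.range fun u => G u z) :=
  ⟨C + K * ‖z‖, by rintro _ ⟨u, rfl⟩; exact (abs_le.1 (lipFamily_le hL h0 u z)).2⟩

variable [Nonempty ι]

theorem lipFamily_abs_iSup_le (hL : ∀ u z z', G u z ≤ G u z' + K * ‖z - z'‖)
    (h0 : ∀ u, |G u 0| ≤ C) (z : M) : |⨆ u, G u z| ≤ C + K * ‖z‖ := by
  obtain ⟨u⟩ := ‹Nonempty ι›
  exact abs_le.2 ⟨(abs_le.1 (lipFamily_le hL h0 u z)).1.trans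
    (le_ciSup (lipFamily_bddAbove hL h0 z) u),
    ciSup_le fun u => (abs_le.1 (lipFamily_le hL h0 u z)).2⟩

/-- A uniform Lipschitz constant passes to the supremum. This gives measurability although the index
set is uncountable. -/
theorem lipFamily_continuous (hK : 0 ≤ K) (hL : ∀ u z z', G u z ≤ G u z' + K * ‖z - z'‖)
    (h0 : ∀ u, |G u 0| ≤ C) : Continuous fun z => ⨆ u, G u z := by
  refine (LipschitzWith.of_le_add_mul ⟨K, hK⟩ fun z z' => ciSup_le fun u => ?_).continuous
  rw [dist_eq_norm]
  exact (hL u z z').trans (add_le_add_left (le_ciSup (lipFamily_bddAbove hL h0 z') u) _)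

theorem integrable_of_linear_growth {N : Type*} [MeasurableSpace N] {f : N → ℝ}
    {w : N → ℝ} {ν : Measure N} [IsFiniteMeasure ν] (hf : AEStronglyMeasurable f ν)
    (hw : Integrable w ν) {A B : ℝ} (h : ∀ z, |f z| ≤ A + B * w z) : Integrable f ν :=
  ((integrable_const A).add (hw.const_mul B)).mono' hf (Filter.Eventually.of_forall h)

theorem lipFamily_integrable [MeasurableSpace M] [BorelSpace M] [SecondCountableTopology M]
    {ν : Measure M} [IsFiniteMeasure ν] (hν : Integrable (fun z => ‖z‖) ν) (hK : 0 ≤ K)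
    (hL : ∀ u z z', G u z ≤ G u z' + K * ‖z - z'‖)
    (h0 : ∀ u, |G u 0| ≤ C) : Integrable (fun z => ⨆ u, G u z) ν :=
  integrable_of_linear_growth (lipFamily_continuous hK hL h0).aestronglyMeasurable hν
    (lipFamily_abs_iSup_le hL h0)

end LipschitzFamily

theorem integral_sqrt_le {N : Type*} [MeasurableSpace N] {ν : Measure N} [IsProbabilityMeasure ν] {f : N → ℝ}
    (hf : Integrable f ν) (h0 : ∀ z, 0 ≤ f z) :
    ∫ z, Real.sqrt (f z) ∂ν ≤ Real.sqrt (∫ z, f z ∂ν) := by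
  have hi : Integrable (fun z => Real.sqrt (f z)) ν := by
    refine integrable_of_linear_growth (A := 1) (B := 1)
      (Real.continuous_sqrt.comp_aestronglyMeasurable hf.1) hf fun z => ?_
    rw [abs_of_nonneg (Real.sqrt_nonneg _), Real.sqrt_le_left (by linarith [h0 z])]
    nlinarith [h0 z]
  exact Real.strictConcaveOn_sqrt.concaveOn.le_map_integral Real.continuous_sqrt.continuousOn
    isClosed_Ici (Filter.Eventually.of_forall h0) hf hi

theorem integrable_norm_pi {E : Type*} [NormedAddCommGroup E] [MeasurableSpace E] [BorelSpace E]
    [SecondCountableTopology E] {k : ℕ} (ν : Fin k → Measure E)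
    [∀ i, IsProbabilityMeasure (ν i)]
    (hν : ∀ i, Integrable (fun z => ‖z‖) (ν i)) :
    Integrable (fun y : Fin k → E => ‖y‖) (Measure.pi ν) := by
  refine (integrable_finsetSum Finset.univ fun i _ => integrable_comp_eval (hν i)).mono'
    (by fun_prop) (Filter.Eventually.of_forall fun y => ?_)
  rw [norm_norm]
  refine (pi_norm_le_iff_of_nonneg (Finset.sum_nonneg fun _ _ => norm_nonneg _)).2 fun i => ?_
  exact Finset.single_le_sum (f := fun i => ‖y i‖) (fun _ _ => norm_nonneg _) (Finset.mem_univ i)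

/-! ### Symmetrization and contraction -/

section Symmetrization

variable {E : Type*} [NormedAddCommGroup E] [InnerProductSpace ℝ E]

/-- The closed unit ball. -/
abbrev UnitBall (E : Type*) [NormedAddCommGroup E] : Type _ := Metric.closedBall (0 : E) 1

instance : Nonempty (UnitBall E) := ⟨⟨0, by simp⟩⟩

theorem abs_inner_unitBall_le (u : UnitBall E) (z : E) : |inner ℝ (u : E) z| ≤ ‖z‖ := by
  have hu : ‖(u : E)‖ ≤ 1 := mem_closedBall_zero_iff.1 u.2
  calc _ ≤ ‖(u : E)‖ * ‖z‖ := abs_real_inner_le_norm _ _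
    _ ≤ 1 * ‖z‖ := mul_le_mul_of_nonneg_right hu (norm_nonneg _)
    _ = _ := one_mul _

theorem inner_unitBall_le_add (u : UnitBall E) (z z' : E) :
    |inner ℝ (u : E) z - inner ℝ (u : E) z'| ≤ ‖z - z'‖ := by
  rw [← inner_sub_right]
  exact abs_inner_unitBall_le _ _

theorem lipFamily_of_lipschitz {h : UnitBall E → ℝ} {φ : ℝ → ℝ} {c : ℝ}
    (hφ : ∀ s t, φ s ≤ φ t + c * |s - t|) (hc : 0 ≤ c) (u : UnitBall E) (z z' : E) :
    h u + φ (inner ℝ (u : E) z) ≤ h u + φ (inner ℝ (u : E) z') + c * ‖z - z'‖ := by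
  have h1 := hφ (inner ℝ (u : E) z) (inner ℝ (u : E) z')
  have h2 := mul_le_mul_of_nonneg_left (inner_unitBall_le_add u z z') hc
  linarith

/-- Contraction for the absolute value: given near-maximizers u and v on the left, 2(|s| - |t|) ≤
2|s - t|, and the sign of s - t decides which of them enters which supremum on the right. -/
theorem iSup_add_iSup_abs_le {h : UnitBall E → ℝ} {C : ℝ} (hC : ∀ u, |h u| ≤ C) (z : E) :
    (⨆ u : UnitBall E, (h u + 2 * |inner ℝ (u : E) z|)) +
      (⨆ u : UnitBall E, (h u + -2 * |inner ℝ (u : E) z|)) ≤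
    (⨆ u : UnitBall E, (h u + 2 * inner ℝ (u : E) z)) +
      ⨆ u : UnitBall E, (h u + -2 * inner ℝ (u : E) z) := by
  have hb : ∀ c : ℝ, BddAbove (Set.range fun u : UnitBall E => h u + c * inner ℝ (u : E) z) := by
    refine fun c => ⟨C + |c| * ‖z‖, ?_⟩
    rintro _ ⟨u, rfl⟩
    have h1 := (le_abs_self _).trans (abs_mul c (inner ℝ (u : E) z)).le
    have h2 := mul_le_mul_of_nonneg_left (abs_inner_unitBall_le u z) (abs_nonneg c)
    have h3 := (abs_le.1 (hC u)).2
    linarith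
  set R := (⨆ u : UnitBall E, (h u + 2 * inner ℝ (u : E) z)) +
      ⨆ u : UnitBall E, (h u + -2 * inner ℝ (u : E) z) with hR
  have key : ∀ u v : UnitBall E,
      (h u + 2 * |inner ℝ (u : E) z|) + (h v + -2 * |inner ℝ (v : E) z|) ≤ R := by
    intro u v
    have h1 := le_ciSup (hb 2) u
    have h2 := le_ciSup (hb (-2)) v
    have h3 := le_ciSup (hb 2) v
    have h4 := le_ciSup (hb (-2)) u
    have h5 := abs_sub_abs_le_abs_sub (inner ℝ (u : E) z) (inner ℝ (v : E) z)
    rcases abs_cases ((inner ℝ (u : E) z : ℝ) - inner ℝ (v : E) z) with ⟨h6, -⟩ | ⟨h6, -⟩ <;>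
      linarith
  have h1 : ∀ v : UnitBall E, (⨆ u : UnitBall E, (h u + 2 * |inner ℝ (u : E) z|)) ≤
      R - (h v + -2 * |inner ℝ (v : E) z|) :=
    fun v => ciSup_le fun u => by linarith [key u v]
  have h2 : (⨆ u : UnitBall E, (h u + -2 * |inner ℝ (u : E) z|)) ≤
      R - ⨆ u : UnitBall E, (h u + 2 * |inner ℝ (u : E) z|) :=
    ciSup_le fun v => by linarith [h1 v]
  linarith

variable [MeasurableSpace E]

/-- The centred process `⟨u, a⟩ + ∑ᵢ (|⟨u, yᵢ⟩| - E |⟨u, ·⟩|)`. -/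
def centeredSum {k : ℕ} (ν : Fin k → Measure E) (u : UnitBall E) (p : E × (Fin k → E)) : ℝ :=
  inner ℝ (u : E) p.1 + ∑ i, (|inner ℝ (u : E) (p.2 i)| - ∫ z, |inner ℝ (u : E) z| ∂ν i)

theorem centeredSum_lip {k : ℕ} (ν : Fin k → Measure E) (u : UnitBall E)
    (p p' : E × (Fin k → E)) :
    centeredSum ν u p ≤ centeredSum ν u p' + (1 + k) * ‖p - p'‖ := by
  have h1 : inner ℝ (u : E) p.1 ≤ inner ℝ (u : E) p'.1 + ‖p - p'‖ := by
    have := (le_abs_self _).trans (inner_unitBall_le_add u p.1 p'.1)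
    have h2 : ‖p.1 - p'.1‖ ≤ ‖p - p'‖ := norm_fst_le (p - p')
    linarith
  have h2 : ∀ i, |inner ℝ (u : E) (p.2 i)| - ∫ z, |inner ℝ (u : E) z| ∂ν i ≤
      |inner ℝ (u : E) (p'.2 i)| - ∫ z, |inner ℝ (u : E) z| ∂ν i + ‖p - p'‖ := fun i => by
    have h3 := (abs_sub_abs_le_abs_sub _ _).trans (inner_unitBall_le_add u (p.2 i) (p'.2 i))
    have h4 : ‖p.2 i - p'.2 i‖ ≤ ‖p - p'‖ :=
      (norm_le_pi_norm (p.2 - p'.2) i).trans (norm_snd_le (p - p'))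
    linarith
  have h3 := Finset.sum_le_sum fun i (_ : i ∈ Finset.univ) => h2 i
  rw [Finset.sum_add_distrib] at h3
  simp only [Finset.sum_const, Finset.card_univ, Fintype.card_fin, nsmul_eq_mul] at h3
  unfold centeredSum
  linarith

variable [BorelSpace E] [SecondCountableTopology E]

theorem integrable_abs_inner {ν : Measure E} [IsFiniteMeasure ν]
    (hν : Integrable (fun z => ‖z‖) ν) (u : UnitBall E) :
    Integrable (fun z => |inner ℝ (u : E) z|) ν :=
  integrable_of_linear_growth (A := 0) (B := 1) (by fun_prop) hν fun z => by
    rw [abs_abs]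
    linarith [abs_inner_unitBall_le u z]

theorem integral_abs_inner_mem {ν : Measure E} [IsFiniteMeasure ν]
    (hν : Integrable (fun z => ‖z‖) ν) (u : UnitBall E) :
    0 ≤ ∫ z, |inner ℝ (u : E) z| ∂ν ∧ ∫ z, |inner ℝ (u : E) z| ∂ν ≤ ∫ z, ‖z‖ ∂ν :=
  ⟨integral_nonneg fun _ => abs_nonneg _,
    integral_mono (integrable_abs_inner hν u) hν fun z => abs_inner_unitBall_le u z⟩

/-- Symmetrization and contraction in one coordinate. -/
theorem integral_iSup_centered_le {ν : Measure E} [IsProbabilityMeasure ν]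
    (hν : Integrable (fun z => ‖z‖) ν) {h : UnitBall E → ℝ} {C : ℝ} (hC : ∀ u, |h u| ≤ C) :
    ∫ z, (⨆ u : UnitBall E, (h u + (|inner ℝ (u : E) z| - ∫ w, |inner ℝ (u : E) w| ∂ν))) ∂ν ≤
      ∫ z, ((⨆ u : UnitBall E, (h u + 2 * inner ℝ (u : E) z)) +
        ⨆ u : UnitBall E, (h u + -2 * inner ℝ (u : E) z)) / 2 ∂ν := by
  set m : UnitBall E → ℝ := fun u => ∫ w, |inner ℝ (u : E) w| ∂ν with hm
  set M := ∫ z, ‖z‖ ∂ν with hM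
  have hmM : ∀ u, 0 ≤ m u ∧ m u ≤ M := fun u => integral_abs_inner_mem hν u
  have hC' : ∀ u, |h u - m u| ≤ C + M := fun u => by
    have h1 := abs_le.1 (hC u)
    have h2 := hmM u
    exact abs_le.2 ⟨by linarith, by linarith⟩
  -- the families involved
  have labs : ∀ s t : ℝ, |s| ≤ |t| + 1 * |s - t| := fun s t => by
    linarith [abs_sub_abs_le_abs_sub s t]
  have labs2 : ∀ s t : ℝ, 2 * |s| ≤ 2 * |t| + 2 * |s - t| := fun s t => by
    linarith [abs_sub_abs_le_abs_sub s t]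
  have labs2' : ∀ s t : ℝ, -2 * |s| ≤ -2 * |t| + 2 * |s - t| := fun s t => by
    have := abs_sub_abs_le_abs_sub t s
    rw [abs_sub_comm] at this
    linarith
  have lin2 : ∀ s t : ℝ, 2 * s ≤ 2 * t + 2 * |s - t| := fun s t => by
    linarith [le_abs_self (s - t)]
  have lin2' : ∀ s t : ℝ, -2 * s ≤ -2 * t + 2 * |s - t| := fun s t => by
    linarith [neg_abs_le (s - t)]
  have I1 : Integrable (fun z => ⨆ u : UnitBall E, ((h u - m u) + |inner ℝ (u : E) z|)) ν :=
    lipFamily_integrable hν zero_le_one (lipFamily_of_lipschitz labs zero_le_one)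
      (fun u => by simpa using hC' u)
  have I2 : Integrable (fun z => ⨆ u : UnitBall E, (h u + 2 * |inner ℝ (u : E) z|)) ν :=
    lipFamily_integrable hν zero_le_two (lipFamily_of_lipschitz labs2 zero_le_two)
      (fun u => by simpa using hC u)
  have I3 : Integrable (fun z => ⨆ u : UnitBall E, (h u + -2 * |inner ℝ (u : E) z|)) ν :=
    lipFamily_integrable hν zero_le_two
      (lipFamily_of_lipschitz (φ := fun t => -2 * |t|) labs2' zero_le_two)
      (fun u => by simpa using hC u)
  have I4 : Integrable (fun z => ⨆ u : UnitBall E, (h u + 2 * inner ℝ (u : E) z)) ν :=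
    lipFamily_integrable hν zero_le_two (lipFamily_of_lipschitz lin2 zero_le_two)
      (fun u => by simpa using hC u)
  have I5 : Integrable (fun z => ⨆ u : UnitBall E, (h u + -2 * inner ℝ (u : E) z)) ν :=
    lipFamily_integrable hν zero_le_two
      (lipFamily_of_lipschitz (φ := fun t => -2 * t) lin2' zero_le_two)
      (fun u => by simpa using hC u)
  have hb2 : ∀ z : E, BddAbove (Set.range fun u : UnitBall E => h u + 2 * |inner ℝ (u : E) z|) :=
    fun z => lipFamily_bddAbove (lipFamily_of_lipschitz labs2 zero_le_two)
      (fun u => by simpa using hC u) z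
  have hb3 : ∀ z : E, BddAbove (Set.range fun u : UnitBall E => h u + -2 * |inner ℝ (u : E) z|) :=
    fun z => lipFamily_bddAbove
      (lipFamily_of_lipschitz (φ := fun t => -2 * |t|) labs2' zero_le_two)
      (fun u => by simpa using hC u) z
  have hbm : BddAbove (Set.range fun u : UnitBall E => h u + -2 * m u) := by
    refine ⟨C, ?_⟩
    rintro _ ⟨u, rfl⟩
    have h1 := (abs_le.1 (hC u)).2
    have h2 := (hmM u).1
    dsimp only
    linarith
  -- A supremum of integrals is at most the integral of the supremum; this takes the place of an
  -- independent copy.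
  have hJ : (⨆ u : UnitBall E, (h u + -2 * m u)) ≤
      ∫ z, (⨆ u : UnitBall E, (h u + -2 * |inner ℝ (u : E) z|)) ∂ν := by
    refine ciSup_le fun u => ?_
    have h1 : h u + -2 * m u = ∫ z, (h u + -2 * |inner ℝ (u : E) z|) ∂ν := by
      rw [integral_add (integrable_const _) ((integrable_abs_inner hν u).const_mul _),
        integral_const_mul]
      simp
      rfl
    rw [h1]
    exact integral_mono ((integrable_const _).add ((integrable_abs_inner hν u).const_mul _)) I3
      fun z => le_ciSup (hb3 z) u
  calc ∫ z, (⨆ u : UnitBall E, (h u + (|inner ℝ (u : E) z| - m u))) ∂ν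
      = ∫ z, (⨆ u : UnitBall E, ((h u - m u) + |inner ℝ (u : E) z|)) ∂ν := by
        congr 1 with z
        congr 1 with u
        ring
    -- The integrand is the mean of h + 2|⟨u, z⟩| and h - 2m.
    _ ≤ ∫ z, ((⨆ u : UnitBall E, (h u + 2 * |inner ℝ (u : E) z|)) / 2 +
          (⨆ u : UnitBall E, (h u + -2 * m u)) / 2) ∂ν := by
        refine integral_mono I1 ((I2.div_const 2).add (integrable_const _)) fun z => ciSup_le fun u => ?_
        have h1 := le_ciSup (hb2 z) u
        have h2 := le_ciSup hbm u
        linarith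
    _ = (∫ z, (⨆ u : UnitBall E, (h u + 2 * |inner ℝ (u : E) z|)) / 2 ∂ν) +
          (⨆ u : UnitBall E, (h u + -2 * m u)) / 2 := by
        rw [integral_add (I2.div_const 2) (integrable_const _)]
        simp
    _ ≤ (∫ z, (⨆ u : UnitBall E, (h u + 2 * |inner ℝ (u : E) z|)) / 2 ∂ν) +
          ∫ z, (⨆ u : UnitBall E, (h u + -2 * |inner ℝ (u : E) z|)) / 2 ∂ν := by
        rw [integral_div 2 (fun z => ⨆ u : UnitBall E, (h u + -2 * |inner ℝ (u : E) z|))]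
        linarith
    _ = ∫ z, ((⨆ u : UnitBall E, (h u + 2 * |inner ℝ (u : E) z|)) / 2 +
          (⨆ u : UnitBall E, (h u + -2 * |inner ℝ (u : E) z|)) / 2) ∂ν :=
        (integral_add (I2.div_const 2) (I3.div_const 2)).symm
    _ ≤ _ := by
        refine integral_mono ((I2.div_const 2).add (I3.div_const 2)) ((I4.add I5).div_const 2) fun z => ?_
        have := iSup_add_iSup_abs_le hC z
        linarith

theorem centeredSum_zero_le {k : ℕ} (ν : Fin k → Measure E) [∀ i, IsProbabilityMeasure (ν i)]
    (hν : ∀ i, Integrable (fun z => ‖z‖) (ν i)) (u : UnitBall E) :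
    |centeredSum ν u 0| ≤ ∑ i, ∫ z, ‖z‖ ∂ν i := by
  unfold centeredSum
  simp only [Prod.fst_zero, inner_zero_right, zero_add, Prod.snd_zero, Pi.zero_apply, abs_zero,
    zero_sub]
  refine (Finset.abs_sum_le_sum_abs _ _).trans (Finset.sum_le_sum fun i _ => ?_)
  rw [abs_neg, abs_of_nonneg (integral_abs_inner_mem (hν i) u).1]
  exact (integral_abs_inner_mem (hν i) u).2

/-- One coordinate at a time, `integral_iSup_centered_le` replaces |⟨u, z⟩| minus its mean by ±2⟨u,
z⟩, which is absorbed into the linear term as a ± 2z. Averaging over the sign cancels the cross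
terms, and Jensen for the square root finishes the step. -/
theorem integral_iSup_centeredSum_le {k : ℕ} (ν : Fin k → Measure E)
    [∀ i, IsProbabilityMeasure (ν i)] (hν : ∀ i, Integrable (fun z => ‖z‖) (ν i))
    (hν2 : ∀ i, Integrable (fun z => ‖z‖ ^ 2) (ν i)) (a : E) :
    ∫ y, (⨆ u : UnitBall E, centeredSum ν u (a, y)) ∂Measure.pi ν ≤
      Real.sqrt (‖a‖ ^ 2 + 4 * ∑ i, ∫ z, ‖z‖ ^ 2 ∂ν i) := by
  induction k generalizing a with
  | zero =>
    rw [Measure.pi_of_empty ν default]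
    simp only [integral_dirac, Finset.univ_eq_empty, Finset.sum_empty, mul_zero, add_zero,
      Real.sqrt_sq (norm_nonneg a)]
    refine ciSup_le fun u => ?_
    simpa [centeredSum] using (le_abs_self _).trans (abs_inner_unitBall_le u a)
  | succ k ih =>
    set ν' : Fin k → Measure E := fun j => ν j.succ with hν'
    set Φ : E × (Fin k → E) → ℝ := fun p => ⨆ u : UnitBall E, centeredSum ν' u p with hΦ
    have hΦc : Continuous Φ := lipFamily_continuous (by positivity) (centeredSum_lip ν')
      (centeredSum_zero_le ν' fun i => hν _)
    set C := ∑ i, ∫ z, ‖z‖ ∂ν' i with hCdef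
    have hΦb : ∀ p, |Φ p| ≤ C + (1 + k) * ‖p‖ := lipFamily_abs_iSup_le (centeredSum_lip ν')
      (centeredSum_zero_le ν' fun i => hν _)
    set Ψ : (Fin (k + 1) → E) → ℝ := fun y => ⨆ u : UnitBall E, centeredSum ν u (a, y) with hΨ
    have hΨc : Continuous Ψ := (lipFamily_continuous (by positivity) (centeredSum_lip ν)
      (centeredSum_zero_le ν hν)).comp (by fun_prop : Continuous fun y : Fin (k + 1) → E => (a, y))
    have hΨb : ∀ y, |Ψ y| ≤ (∑ i, ∫ z, ‖z‖ ∂ν i) + (1 + (k + 1 : ℕ)) * ‖(a, y)‖ := fun y =>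
      lipFamily_abs_iSup_le (centeredSum_lip ν) (centeredSum_zero_le ν hν) (a, y)
    set V := ∑ i, ∫ z, ‖z‖ ^ 2 ∂ν' i with hV
    have hV0 : 0 ≤ V := Finset.sum_nonneg fun i _ => integral_nonneg fun z => by positivity
    have hpair : Integrable (fun p : E × (Fin k → E) => ‖p.1‖ + ‖p.2‖)
        ((ν 0).prod (Measure.pi ν')) :=
      ((hν 0).comp_fst _).add ((integrable_norm_pi ν' fun i => hν _).comp_snd _)
    have hcons : Continuous fun p : E × (Fin k → E) => (Fin.cons p.1 p.2 : Fin (k + 1) → E) := by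
      refine continuous_pi fun i => Fin.cases ?_ (fun j => ?_) i
      · simpa using continuous_fst
      · simp only [Fin.cons_succ]
        fun_prop
    have hΨi : Integrable (fun p : E × (Fin k → E) => Ψ (Fin.cons p.1 p.2))
        ((ν 0).prod (Measure.pi ν')) := by
      refine integrable_of_linear_growth
        (A := (∑ i, ∫ z, ‖z‖ ∂ν i) + (1 + (k + 1 : ℕ)) * ‖a‖) (B := 1 + (k + 1 : ℕ))
        (hΨc.comp hcons).aestronglyMeasurable hpair fun p => (hΨb _).trans ?_
      have h1 : ‖(a, (Fin.cons p.1 p.2 : Fin (k + 1) → E))‖ ≤ ‖a‖ + (‖p.1‖ + ‖p.2‖) := by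
        refine (max_le (by simp; positivity) ?_)
        refine (pi_norm_le_iff_of_nonneg (by positivity)).2 fun i => Fin.cases ?_ (fun j => ?_) i
        · simp only [Fin.cons_zero]
          linarith [norm_nonneg a, norm_nonneg p.2]
        · simp only [Fin.cons_succ]
          linarith [norm_nonneg a, norm_nonneg p.1, norm_le_pi_norm p.2 j]
      have h2 := mul_le_mul_of_nonneg_left h1 (by positivity : (0 : ℝ) ≤ 1 + (k + 1 : ℕ))
      linarith
    have hΦi : ∀ c : ℝ, Integrable (fun p : E × (Fin k → E) => Φ (a + c • p.1, p.2))
        ((ν 0).prod (Measure.pi ν')) := by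
      intro c
      refine integrable_of_linear_growth (A := C + (1 + k) * ‖a‖) (B := (1 + k) * (1 + |c|))
        (hΦc.comp (by fun_prop)).aestronglyMeasurable hpair fun p => (hΦb _).trans ?_
      have h1 : ‖(a + c • p.1, p.2)‖ ≤ ‖a‖ + (1 + |c|) * (‖p.1‖ + ‖p.2‖) := by
        have h3 : 0 ≤ |c| * ‖p.2‖ := by positivity
        have h4 : 0 ≤ |c| * ‖p.1‖ := by positivity
        refine max_le ?_ ?_
        · refine (norm_add_le _ _).trans ?_
          rw [norm_smul, Real.norm_eq_abs]
          linarith [norm_nonneg p.1, norm_nonneg p.2]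
        · linarith [norm_nonneg p.1, norm_nonneg a]
      have h2 := mul_le_mul_of_nonneg_left h1 (by positivity : (0 : ℝ) ≤ 1 + k)
      linarith
    have hΦ2 : ∀ c : ℝ, Integrable (fun z => ∫ y, Φ (a + c • z, y) ∂Measure.pi ν') (ν 0) :=
      fun c => (hΦi c).integral_prod_left
    have hinner : ∀ y, ∫ z, Ψ (Fin.cons z y) ∂ν 0 ≤
        ∫ z, (Φ (a + (2 : ℝ) • z, y) + Φ (a + (-2 : ℝ) • z, y)) / 2 ∂ν 0 := by
      intro y
      have h := integral_iSup_centered_le (hν 0) (h := fun u => centeredSum ν' u (a, y))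
        (fun u => lipFamily_le (centeredSum_lip ν')
          (centeredSum_zero_le ν' fun i => hν _) u (a, y))
      convert h using 4 with z z
      · congr 1 with u
        simp only [centeredSum, Fin.sum_univ_succ, Fin.cons_zero, Fin.cons_succ]
        ring
      · simp only [hΦ]
        congr 2 <;>
        · ext u
          simp only [centeredSum, inner_add_right, inner_smul_right]
          ring
    rw [integral_pi_succ ν hΨc.aestronglyMeasurable, integral_prod_symm _ hΨi]
    calc ∫ y, ∫ z, Ψ (Fin.cons z y) ∂ν 0 ∂Measure.pi ν'
        ≤ ∫ y, ∫ z, (Φ (a + (2 : ℝ) • z, y) + Φ (a + (-2 : ℝ) • z, y)) / 2 ∂ν 0 ∂Measure.pi ν' :=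
          integral_mono hΨi.integral_prod_right
            (((hΦi 2).add (hΦi (-2))).div_const 2).integral_prod_right hinner
      _ = ∫ z, ∫ y, (Φ (a + (2 : ℝ) • z, y) + Φ (a + (-2 : ℝ) • z, y)) / 2 ∂Measure.pi ν' ∂ν 0 :=
          (integral_integral_swap (((hΦi 2).add (hΦi (-2))).div_const 2)).symm
      _ = ∫ z, (∫ y, Φ (a + (2 : ℝ) • z, y) ∂Measure.pi ν' +
            ∫ y, Φ (a + (-2 : ℝ) • z, y) ∂Measure.pi ν') / 2 ∂ν 0 := by
          refine integral_congr_ae ?_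
          filter_upwards [(hΦi 2).prod_right_ae, (hΦi (-2)).prod_right_ae] with z h1 h2
          rw [integral_div, integral_add h1 h2]
      _ ≤ ∫ z, Real.sqrt (‖a‖ ^ 2 + 4 * ‖z‖ ^ 2 + 4 * V) ∂ν 0 := by
          have hfi : Integrable (fun z => ‖a‖ ^ 2 + 4 * ‖z‖ ^ 2 + 4 * V) (ν 0) :=
            ((integrable_const _).add ((hν2 0).const_mul 4)).add (integrable_const _)
          refine integral_mono (((hΦ2 2).add (hΦ2 (-2))).div_const 2) ?_ fun z => ?_
          · refine integrable_of_linear_growth (A := 1) (B := 1) (by fun_prop) hfi fun z => ?_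
            rw [abs_of_nonneg (Real.sqrt_nonneg _), Real.sqrt_le_left (by positivity)]
            nlinarith [sq_nonneg ‖a‖, sq_nonneg ‖z‖]
          · have h1 := ih ν' (fun i => hν _) (fun i => hν2 _) (a + (2 : ℝ) • z)
            have h2 := ih ν' (fun i => hν _) (fun i => hν2 _) (a + (-2 : ℝ) • z)
            have e1 : ‖a + (2 : ℝ) • z‖ ^ 2 = ‖a‖ ^ 2 + 4 * inner ℝ a z + 4 * ‖z‖ ^ 2 := by
              rw [norm_add_sq_real, inner_smul_right, norm_smul, mul_pow, Real.norm_eq_abs, sq_abs]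
              ring
            have e2 : ‖a + (-2 : ℝ) • z‖ ^ 2 = ‖a‖ ^ 2 - 4 * inner ℝ a z + 4 * ‖z‖ ^ 2 := by
              rw [norm_add_sq_real, inner_smul_right, norm_smul, mul_pow, Real.norm_eq_abs, sq_abs]
              ring
            have n1 : 0 ≤ ‖a + (2 : ℝ) • z‖ ^ 2 + 4 * V := by positivity
            have n2 : 0 ≤ ‖a + (-2 : ℝ) • z‖ ^ 2 + 4 * V := by positivity
            have s1 := Real.sq_sqrt n1
            have s2 := Real.sq_sqrt n2
            change (∫ y, Φ (a + (2 : ℝ) • z, y) ∂Measure.pi ν' +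
              ∫ y, Φ (a + (-2 : ℝ) • z, y) ∂Measure.pi ν') / 2 ≤ _
            refine Real.le_sqrt_of_sq_le ?_ |>.trans' ?_ (b := (Real.sqrt (‖a + (2 : ℝ) • z‖ ^ 2 + 4 * V) +
              Real.sqrt (‖a + (-2 : ℝ) • z‖ ^ 2 + 4 * V)) / 2)
            rotate_left
            · linarith
            · have h5 : ∀ s t : ℝ, ((s + t) / 2) ^ 2 ≤ (s ^ 2 + t ^ 2) / 2 := fun s t => by
                nlinarith [sq_nonneg (s - t)]
              refine (h5 _ _).trans ?_
              rw [s1, s2, e1, e2]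
              linarith
      _ ≤ Real.sqrt (∫ z, (‖a‖ ^ 2 + 4 * ‖z‖ ^ 2 + 4 * V) ∂ν 0) :=
          integral_sqrt_le (((integrable_const _).add ((hν2 0).const_mul 4)).add
            (integrable_const _)) fun z => by positivity
      _ = _ := by
          rw [integral_add (f := fun z : E => ‖a‖ ^ 2 + 4 * ‖z‖ ^ 2)
              ((integrable_const _).add ((hν2 0).const_mul 4)) (integrable_const _),
            integral_add (integrable_const _) ((hν2 0).const_mul 4), integral_const_mul,
            Fin.sum_univ_succ]
          simp only [integral_const, probReal_univ, one_smul]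
          congr 1
          rw [hV]
          ring

end Symmetrization

/-! ### The `2 → 1` norm and its semidefinite relaxation -/

section Relaxation

variable {E : Type*} [NormedAddCommGroup E] [InnerProductSpace ℝ E] {k : ℕ}

/-- The supremum over the unit ball of `∑ᵢ |⟨u, yᵢ⟩|`. -/
def absSup (y : Fin k → E) : ℝ := ⨆ u : UnitBall E, ∑ i, |inner ℝ (u : E) (y i)|

theorem absSup_lip (u : UnitBall E) (y y' : Fin k → E) :
    ∑ i, |inner ℝ (u : E) (y i)| ≤ ∑ i, |inner ℝ (u : E) (y' i)| + k * ‖y - y'‖ := by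
  have h : ∀ i, |inner ℝ (u : E) (y i)| ≤ |inner ℝ (u : E) (y' i)| + ‖y - y'‖ := fun i => by
    have h3 := (abs_sub_abs_le_abs_sub _ _).trans (inner_unitBall_le_add u (y i) (y' i))
    have h4 : ‖y i - y' i‖ ≤ ‖y - y'‖ := norm_le_pi_norm (y - y') i
    linarith
  have h3 := Finset.sum_le_sum fun i (_ : i ∈ Finset.univ) => h i
  rw [Finset.sum_add_distrib] at h3
  simpa using h3

theorem absSup_zero (u : UnitBall E) :
    |(∑ i : Fin k, |inner ℝ (u : E) ((0 : Fin k → E) i)|)| ≤ 0 := by simp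

theorem sum_abs_inner_le_absSup (u : UnitBall E) (y : Fin k → E) :
    ∑ i, |inner ℝ (u : E) (y i)| ≤ absSup y :=
  le_ciSup (lipFamily_bddAbove (G := fun (u : UnitBall E) (y : Fin k → E) =>
    ∑ i, |inner ℝ (u : E) (y i)|) absSup_lip absSup_zero y) u

theorem absSup_nonneg (y : Fin k → E) : 0 ≤ absSup y := by
  simpa using sum_abs_inner_le_absSup ⟨0, by simp⟩ y

theorem sum_abs_inner_le_norm_mul (u : E) (y : Fin k → E) :
    ∑ i, |inner ℝ u (y i)| ≤ ‖u‖ * absSup y := by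
  rcases (norm_nonneg u).eq_or_lt with h | h
  · rw [norm_eq_zero.1 h.symm]
    simp
  · have h1 := sum_abs_inner_le_absSup ⟨‖u‖⁻¹ • u, by simp [norm_smul, h.ne']⟩ y
    simp only [inner_smul_left, RCLike.conj_to_real, abs_mul, abs_inv, abs_norm,
      ← Finset.mul_sum] at h1
    rwa [inv_mul_le_iff₀ h] at h1

/-- The families of vectors over which the relaxation optimizes: on them the relaxation exceeds the
`2 → 1` norm by at most a constant factor. -/
def Admissible (W : Fin k → E) : Prop :=
  (∀ i, ‖W i‖ ≤ 1) ∧ ∀ y : Fin k → E, ∑ i, |inner ℝ (W i) (y i)| ≤ 7 / 4 * absSup y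

instance : Nonempty {W : Fin k → E // Admissible W} :=
  ⟨⟨0, by simp, fun y => by simpa using absSup_nonneg y⟩⟩

/-- Rounding of the relaxation, by random signs. -/
theorem sum_sqrt_le_absSup {m : ℕ} (V : Fin m → E) (hV : ∑ l, ‖V l‖ ^ 2 ≤ 1) (y : Fin k → E) :
    ∑ i, Real.sqrt (∑ l, inner ℝ (V l) (y i) ^ 2) ≤ 7 / 4 * absSup y := by
  set L := List.ofFn V with hL
  have h1 : ∀ i, 4 / 7 * Real.sqrt (∑ l, inner ℝ (V l) (y i) ^ 2) ≤
      signAvg L (fun u => |inner ℝ u (y i)|) 0 := fun i => by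
    have := le_signAvg_abs_inner L (y i)
    rwa [hL, List.map_ofFn, List.sum_ofFn] at this
  have h2 : ∑ i, signAvg L (fun u => |inner ℝ u (y i)|) 0 ≤ absSup y := by
    rw [← signAvg_sum]
    -- By ‖u‖ ≤ (1 + ‖u‖²)/2 only the second moment of the signed sum is needed, and it is ∑ ‖V l‖²
    -- ≤ 1.
    calc _ ≤ signAvg L (fun u => absSup y * (1 / 2 * (1 + ‖u‖ ^ 2))) 0 := by
          refine signAvg_mono L (fun u => (sum_abs_inner_le_norm_mul u y).trans ?_) 0
          have := absSup_nonneg y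
          nlinarith [sq_nonneg (‖u‖ - 1)]
      _ = absSup y * (1 / 2 * (1 + ∑ l, ‖V l‖ ^ 2)) := by
          rw [signAvg_const_mul, signAvg_const_mul, signAvg_add, signAvg_const, signAvg_norm_sq,
            hL, List.map_ofFn, List.sum_ofFn]
          simp
      _ ≤ absSup y * 1 := mul_le_mul_of_nonneg_left (by linarith) (absSup_nonneg y)
      _ = _ := mul_one _
  have h3 := (Finset.sum_le_sum fun i (_ : i ∈ Finset.univ) => h1 i).trans h2
  rw [← Finset.mul_sum] at h3
  linarith

theorem admissible_of_gram {m : ℕ} (V : Fin m → E) (hV : ∑ l, ‖V l‖ ^ 2 ≤ 1)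
    (b : Fin k → Fin m → ℝ) (hb : ∀ i, ∑ l, b i l ^ 2 ≤ 1) :
    Admissible fun i => ∑ l, b i l • V l := by
  have key : ∀ i z, |inner ℝ (∑ l, b i l • V l) z| ≤ Real.sqrt (∑ l, inner ℝ (V l) z ^ 2) := by
    intro i z
    refine Real.abs_le_sqrt ?_
    simp only [sum_inner, inner_smul_left, RCLike.conj_to_real]
    refine (Finset.sum_mul_sq_le_sq_mul_sq _ _ _).trans ?_
    exact mul_le_of_le_one_left (by positivity) (hb i)
  refine ⟨fun i => ?_, fun y => (Finset.sum_le_sum fun i _ => key i (y i)).trans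
    (sum_sqrt_le_absSup V hV y)⟩
  set w := ∑ l, b i l • V l with hw
  have h1 := (le_abs_self _).trans (key i w)
  rw [← hw, real_inner_self_eq_norm_sq] at h1
  have h2 : Real.sqrt (∑ l, inner ℝ (V l) w ^ 2) ≤ ‖w‖ := by
    refine Real.sqrt_le_iff.2 ⟨norm_nonneg _, ?_⟩
    calc _ ≤ ∑ l, ‖V l‖ ^ 2 * ‖w‖ ^ 2 := by
          refine Finset.sum_le_sum fun l _ => ?_
          rw [← mul_pow, ← sq_abs]
          exact pow_le_pow_left₀ (abs_nonneg _) (abs_real_inner_le_norm _ _) 2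
      _ ≤ _ := by
          rw [← Finset.sum_mul]
          exact mul_le_of_le_one_left (by positivity) hV
  nlinarith [norm_nonneg w]

/-- Truncation to `[0, 1]`. -/
def clamp (t : ℝ) : ℝ := max 0 (min 1 t)

theorem clamp_nonneg (t : ℝ) : 0 ≤ clamp t := le_max_left _ _

theorem clamp_le_one (t : ℝ) : clamp t ≤ 1 := max_le zero_le_one (min_le_left _ _)

theorem clamp_le_abs (t : ℝ) : clamp t ≤ |t| :=
  max_le (abs_nonneg t) ((min_le_right _ _).trans (le_abs_self t))

theorem le_clamp {s t : ℝ} (h1 : s ≤ 1) (h2 : s ≤ t) : s ≤ clamp t := le_max_of_le_right (le_min h1 h2)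

theorem clamp_le_add (s t : ℝ) : clamp s ≤ clamp t + |s - t| := by
  refine max_le (add_nonneg (clamp_nonneg t) (abs_nonneg _)) ?_
  rcases le_total 1 t with h | h
  · have : (1 : ℝ) ≤ clamp t := le_clamp le_rfl h
    linarith [min_le_left 1 s, abs_nonneg (s - t)]
  · have : t ≤ clamp t := le_clamp h le_rfl
    linarith [min_le_right 1 s, le_abs_self (s - t)]

/-- The truncated relaxation; its value bounds the value of the semidefinite program. -/
def clampSup (ρ : ℝ) (y : Fin k → E) : ℝ :=
  ⨆ W : {W : Fin k → E // Admissible W}, ∑ i, clamp (inner ℝ (W.1 i) (y i) / ρ)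

theorem clampSum_mem (ρ : ℝ) (W : Fin k → E) (y : Fin k → E) :
    |∑ i, clamp (inner ℝ (W i) (y i) / ρ)| ≤ k := by
  rw [abs_of_nonneg (Finset.sum_nonneg fun i _ => clamp_nonneg _)]
  simpa using Finset.sum_le_card_nsmul Finset.univ (fun i => clamp (inner ℝ (W i) (y i) / ρ)) 1
    fun i _ => clamp_le_one _

theorem clampSum_lip {ρ : ℝ} (hρ : 0 < ρ) (W : {W : Fin k → E // Admissible W})
    (y y' : Fin k → E) :
    ∑ i, clamp (inner ℝ (W.1 i) (y i) / ρ) ≤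
      ∑ i, clamp (inner ℝ (W.1 i) (y' i) / ρ) + k / ρ * ‖y - y'‖ := by
  have h : ∀ i, clamp (inner ℝ (W.1 i) (y i) / ρ) ≤
      clamp (inner ℝ (W.1 i) (y' i) / ρ) + ‖y - y'‖ / ρ := fun i => by
    refine (clamp_le_add _ (inner ℝ (W.1 i) (y' i) / ρ)).trans ?_
    gcongr
    rw [← sub_div, ← inner_sub_right, abs_div, abs_of_pos hρ]
    gcongr
    calc _ ≤ ‖W.1 i‖ * ‖y i - y' i‖ := abs_real_inner_le_norm _ _
      _ ≤ 1 * ‖y - y'‖ := mul_le_mul (W.2.1 i) (norm_le_pi_norm (y - y') i) (norm_nonneg _) one_pos.le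
      _ = _ := one_mul _
  have h3 := Finset.sum_le_sum fun i (_ : i ∈ Finset.univ) => h i
  rw [Finset.sum_add_distrib] at h3
  simp only [Finset.sum_const, Finset.card_univ, Fintype.card_fin, nsmul_eq_mul] at h3
  rwa [div_mul_eq_mul_div, ← mul_div_assoc']

theorem clampSup_bddAbove (ρ : ℝ) (y : Fin k → E) :
    BddAbove (Set.range fun W : {W : Fin k → E // Admissible W} =>
      ∑ i, clamp (inner ℝ (W.1 i) (y i) / ρ)) :=
  ⟨k, by rintro _ ⟨W, rfl⟩; exact (abs_le.1 (clampSum_mem ρ W.1 y)).2⟩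

theorem continuous_clampSup {ρ : ℝ} (hρ : 0 < ρ) :
    Continuous (clampSup ρ : (Fin k → E) → ℝ) :=
  lipFamily_continuous (by positivity) (clampSum_lip hρ) (fun W => clampSum_mem ρ W.1 0)

theorem abs_clampSup_le (ρ : ℝ) (y : Fin k → E) : |clampSup ρ y| ≤ k := by
  refine abs_le.2 ⟨?_, ciSup_le fun W => (abs_le.1 (clampSum_mem ρ W.1 y)).2⟩
  obtain ⟨W⟩ : Nonempty {W : Fin k → E // Admissible W} := inferInstance
  exact (abs_le.1 (clampSum_mem ρ W.1 y)).1.trans (le_ciSup (clampSup_bddAbove ρ y) W)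

/-- The purpose of the truncation: each bin contributes a number in [0, 1], however heavy its tails.
-/
theorem clampSup_update_sub_le (ρ : ℝ) (i : Fin k) (y : Fin k → E) (z : E) :
    clampSup ρ (Function.update y i z) - clampSup ρ y ≤ 1 := by
  rw [sub_le_iff_le_add]
  refine ciSup_le fun W => ?_
  refine le_trans ?_ (add_le_add_right (le_ciSup (clampSup_bddAbove ρ y) W) 1)
  rw [← Finset.add_sum_erase _ _ (Finset.mem_univ i), ← Finset.add_sum_erase
    (f := fun i => clamp (inner ℝ (W.1 i) (y i) / ρ)) _ (Finset.mem_univ i)]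
  have h : ∑ j ∈ Finset.univ.erase i, clamp (inner ℝ (W.1 j) (Function.update y i z j) / ρ) =
      ∑ j ∈ Finset.univ.erase i, clamp (inner ℝ (W.1 j) (y j) / ρ) :=
    Finset.sum_congr rfl fun j hj => by rw [Function.update_of_ne (Finset.ne_of_mem_erase hj)]
  rw [h]
  linarith [clamp_le_one (inner ℝ (W.1 i) (Function.update y i z i) / ρ),
    clamp_nonneg (inner ℝ (W.1 i) (y i) / ρ)]

theorem clampSup_le_absSup {ρ : ℝ} (hρ : 0 < ρ) (y : Fin k → E) :
    clampSup ρ y ≤ 7 / 4 / ρ * absSup y := by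
  refine ciSup_le fun W => ?_
  calc _ ≤ ∑ i, |inner ℝ (W.1 i) (y i)| / ρ := by
        refine Finset.sum_le_sum fun i _ => (clamp_le_abs _).trans_eq ?_
        rw [abs_div, abs_of_pos hρ]
    _ ≤ 7 / 4 * absSup y / ρ := by
        rw [← Finset.sum_div]
        gcongr
        exact W.2.2 y
    _ = _ := by ring

/-! ### Expectation and concentration -/

variable [MeasurableSpace E] [BorelSpace E] [SecondCountableTopology E]

/-- The means E|⟨u, ·⟩| are at most σ each, and the centred remainder is the symmetrized bound at a
= 0. -/
theorem integral_absSup_le (ν : Fin k → Measure E) [∀ i, IsProbabilityMeasure (ν i)]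
    (hν2 : ∀ i, Integrable (fun z => ‖z‖ ^ 2) (ν i)) {σ : ℝ} (hσ0 : 0 ≤ σ)
    (hσ : ∀ i (u : UnitBall E), ∫ z, inner ℝ (u : E) z ^ 2 ∂ν i ≤ σ ^ 2) :
    Integrable absSup (Measure.pi ν) ∧ ∫ y, absSup y ∂Measure.pi ν ≤
      2 * Real.sqrt (∑ i, ∫ z, ‖z‖ ^ 2 ∂ν i) + k * σ := by
  have hν : ∀ i, Integrable (fun z => ‖z‖) (ν i) := fun i =>
    integrable_of_linear_growth (A := 1) (B := 1) (by fun_prop) (hν2 i) fun z => by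
      rw [abs_norm]
      nlinarith [sq_nonneg (‖z‖ - 1), norm_nonneg z]
  have hm : ∀ i (u : UnitBall E), ∫ z, |inner ℝ (u : E) z| ∂ν i ≤ σ := fun i u => by
    have h := integral_sqrt_le (ν := ν i) (f := fun z => (inner ℝ (u : E) z : ℝ) ^ 2)
      (integrable_of_linear_growth (A := 0) (B := 1) (by fun_prop) (hν2 i) fun z => by
        rw [abs_of_nonneg (by positivity), ← sq_abs]
        have := pow_le_pow_left₀ (abs_nonneg _) (abs_inner_unitBall_le u z) 2
        linarith) fun z => by positivity
    simp only [Real.sqrt_sq_eq_abs] at h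
    exact h.trans ((Real.sqrt_le_sqrt (hσ i u)).trans_eq (Real.sqrt_sq hσ0))
  have hint : Integrable absSup (Measure.pi ν) :=
    lipFamily_integrable (integrable_norm_pi ν hν) (Nat.cast_nonneg k) absSup_lip absSup_zero
  refine ⟨hint, ?_⟩
  have hbdd : ∀ y, BddAbove (Set.range fun u : UnitBall E => centeredSum ν u ((0 : E), y)) :=
    fun y => lipFamily_bddAbove (centeredSum_lip ν) (centeredSum_zero_le ν hν) (0, y)
  have hcint : Integrable (fun y => ⨆ u : UnitBall E, centeredSum ν u ((0 : E), y))
      (Measure.pi ν) := by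
    refine integrable_of_linear_growth (A := ∑ i, ∫ z, ‖z‖ ∂ν i) (B := 1 + k) ?_
      (integrable_norm_pi ν hν) fun y => ?_
    · exact ((lipFamily_continuous (by positivity) (centeredSum_lip ν)
        (centeredSum_zero_le ν hν)).comp (by fun_prop : Continuous fun y : Fin k → E =>
          ((0 : E), y))).aestronglyMeasurable
    · have := lipFamily_abs_iSup_le (centeredSum_lip ν) (centeredSum_zero_le ν hν) (0, y)
      simpa [Prod.norm_def] using this
  have h1 : ∀ y, absSup y ≤ (⨆ u : UnitBall E, centeredSum ν u ((0 : E), y)) + k * σ := by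
    intro y
    refine ciSup_le fun u => ?_
    have h2 := le_ciSup (hbdd y) u
    have h3 : ∑ i, ∫ z, |inner ℝ (u : E) z| ∂ν i ≤ k * σ := by
      simpa using Finset.sum_le_card_nsmul Finset.univ _ σ fun i _ => hm i u
    simp only [centeredSum, inner_zero_right, zero_add, Finset.sum_sub_distrib] at h2
    unfold centeredSum
    simp only [inner_zero_right, zero_add, Finset.sum_sub_distrib]
    linarith
  calc ∫ y, absSup y ∂Measure.pi ν
      ≤ ∫ y, ((⨆ u : UnitBall E, centeredSum ν u ((0 : E), y)) + k * σ) ∂Measure.pi ν :=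
        integral_mono hint (hcint.add (integrable_const _)) h1
    _ = ∫ y, (⨆ u : UnitBall E, centeredSum ν u ((0 : E), y)) ∂Measure.pi ν + k * σ := by
        rw [integral_add hcint (integrable_const _)]
        simp
    _ ≤ _ := by
        have h := integral_iSup_centeredSum_le ν hν hν2 0
        rw [norm_zero, zero_pow two_ne_zero, zero_add, Real.sqrt_mul (by norm_num),
          show (4 : ℝ) = 2 ^ 2 by norm_num, Real.sqrt_sq (by norm_num)] at h
        linarith

/-- The budget k/20 is split into 3k/80 for the mean and k/80 for the deviation, and McDiarmid with
τ = 1/80 gives exp(-2k/6400). -/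
theorem measureReal_clampSup_gt_le (ν : Fin k → Measure E) [∀ i, IsProbabilityMeasure (ν i)]
    (hν2 : ∀ i, Integrable (fun z => ‖z‖ ^ 2) (ν i)) {σ ρ : ℝ} (hσ0 : 0 ≤ σ) (hρ : 0 < ρ)
    (hσ : ∀ i (u : UnitBall E), ∫ z, inner ℝ (u : E) z ^ 2 ∂ν i ≤ σ ^ 2)
    (hle : 7 / 4 * (2 * Real.sqrt (∑ i, ∫ z, ‖z‖ ^ 2 ∂ν i) + k * σ) ≤ 3 / 80 * k * ρ) :
    (Measure.pi ν).real {y | (k : ℝ) / 20 < clampSup ρ y} ≤ Real.exp (-(k / 3200)) := by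
  obtain ⟨hint, hN⟩ := integral_absSup_le ν hν2 hσ0 hσ
  have hcm : Measurable (clampSup ρ : (Fin k → E) → ℝ) := (continuous_clampSup hρ).measurable
  have hcint : Integrable (clampSup ρ) (Measure.pi ν) :=
    Integrable.of_bound hcm.aestronglyMeasurable k (Filter.Eventually.of_forall (abs_clampSup_le ρ))
  have hmean : ∫ y, clampSup ρ y ∂Measure.pi ν ≤ 3 / 80 * k := by
    calc _ ≤ ∫ y, 7 / 4 / ρ * absSup y ∂Measure.pi ν :=
          integral_mono hcint (hint.const_mul _) (clampSup_le_absSup hρ)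
      _ ≤ 7 / 4 / ρ * (2 * Real.sqrt (∑ i, ∫ z, ‖z‖ ^ 2 ∂ν i) + k * σ) := by
          rw [integral_const_mul]
          exact mul_le_mul_of_nonneg_left hN (by positivity)
      _ ≤ 3 / 80 * k := by
          rw [div_mul_eq_mul_div, div_le_iff₀ hρ]
          exact hle
  have h := measureReal_ge_le_of_bounded_differences ν hcm (abs_clampSup_le ρ)
    (clampSup_update_sub_le ρ) (τ := 1 / 80) (by norm_num)
  refine (measureReal_mono fun y hy => ?_).trans (h.trans_eq (by congr 1; ring))
  have hy' : (k : ℝ) / 20 < clampSup ρ y := hy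
  change (k : ℝ) * (1 / 80) ≤ clampSup ρ y - _
  linarith

end Relaxation

/-! ### The semidefinite program and its relaxation -/

theorem MTFeasible.admissible_vb {k d : ℕ} {x : Vec d} {r : ℝ} {Z : Fin k → Vec d}
    {X : Matrix (Idx k d) (Idx k d) ℝ} (h : MTFeasible x r Z X) : Admissible (vb X) := by
  obtain ⟨m, B, hB⟩ := posSemidef_iff_exists_gram.1 h.psd
  have hvb : vb X = fun i => ∑ l, B l (Idx.b i) •
      (WithLp.toLp 2 fun j => B l (Idx.v j) : Vec d) := by
    ext i j
    simp [vb, hB, WithLp.ofLp_sum]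
  rw [hvb]
  refine admissible_of_gram _ ?_ _ fun i => ?_
  · have := h.trace_v
    simp only [hB] at this
    rw [Finset.sum_comm] at this
    simp only [EuclideanSpace.real_norm_sq_eq]
    simp only [sq]
    exact this.le
  · have := h.diag_b_le_one i
    rw [hB] at this
    simpa [sq] using this

/-- Each X_bb is at most 1 and, by separation, at most ⟨v_b, Z_i - x⟩ / r; the v_b form an
admissible family. -/
theorem MTFeasible.objective_le_clampSup {k d : ℕ} {x : Vec d} {r : ℝ} (hr : 0 < r)
    {Z : Fin k → Vec d} {X : Matrix (Idx k d) (Idx k d) ℝ} (h : MTFeasible x r Z X) :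
    mtObjective X ≤ clampSup r fun i => Z i - x := by
  rw [h.objective_eq]
  refine le_trans (Finset.sum_le_sum fun i _ => ?_)
    (le_ciSup (clampSup_bddAbove r fun i => Z i - x) ⟨vb X, h.admissible_vb⟩)
  refine le_clamp (h.diag_b_le_one i) ?_
  rw [le_div_iff₀ hr]
  exact h.sep i

/-! ### Independence of functions of disjoint blocks -/

theorem iIndepFun_of_disjoint_blocks {Ω ι κ E β : Type*} [MeasurableSpace Ω] [MeasurableSpace E]
    [MeasurableSpace β] {P : Measure Ω} [IsProbabilityMeasure P] {X : ι → Ω → E}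
    (hX : iIndepFun X P) (hm : ∀ i, Measurable (X i)) (S : κ → Finset ι)
    (hS : ∀ i j, i ≠ j → Disjoint (S i) (S j)) (φ : ∀ i, (S i → E) → β)
    (hφ : ∀ i, Measurable (φ i)) :
    iIndepFun (fun i ω => φ i fun j : S i => X j ω) P := by
  classical
  rw [iIndepFun_iff_measure_inter_preimage_eq_mul]
  intro s C hC
  induction s using Finset.induction_on with
  | empty => simp
  | insert i s hi ih =>
    have ih' := ih fun j hj => hC j (Finset.mem_insert_of_mem hj)
    set T := s.biUnion S with hT
    have hdisj : Disjoint (S i) T := by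
      rw [hT, Finset.disjoint_biUnion_right]
      exact fun j hj => hS i j fun h => hi (h ▸ hj)
    have hmem : ∀ j : s, ∀ l : S j, (l : ι) ∈ T := fun j l =>
      Finset.mem_biUnion.2 ⟨j, j.2, l.2⟩
    -- The events of the earlier blocks are merged into one event on the coordinates in T, which is
    -- disjoint from the new block.
    let D : Set (T → E) := ⋂ j : s, (fun y : T → E => φ j fun l : S j => y ⟨l, hmem j l⟩) ⁻¹' C j
    have hD : MeasurableSet D := MeasurableSet.iInter fun j =>
      ((hφ j).comp (measurable_pi_lambda _ fun l => measurable_pi_apply _))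
        (hC j (Finset.mem_insert_of_mem j.2))
    have hpre : (⋂ j ∈ s, (fun ω => φ j fun l : S j => X l ω) ⁻¹' C j) =
        (fun ω (l : T) => X l ω) ⁻¹' D := by
      ext ω
      simp [D]
    have hind := (hX.indepFun_finset (S i) T hdisj hm).measure_inter_preimage_eq_mul
      (φ i ⁻¹' C i) D (hφ i (hC i (Finset.mem_insert_self i s))) hD
    rw [Finset.set_biInter_insert, Finset.prod_insert hi, ← ih', hpre]
    exact hind

/-! ### Bins -/

section Bins

variable {n k : ℕ}

theorem numBins_pos {δ : ℝ} (hδ0 : 0 < δ) (hδ1 : δ < 1) : 0 < numBins δ := by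
  refine Nat.ceil_pos.2 (mul_pos (by norm_num) (Real.log_pos ?_))
  exact one_lt_one_div hδ0 hδ1

theorem bin_disjoint (i j : Fin k) (h : i ≠ j) : Disjoint (bin n k i) (bin n k j) := by
  wlog hlt : i < j generalizing i j
  · exact (this j i h.symm (lt_of_le_of_ne (not_lt.1 hlt) h.symm)).symm
  rw [Finset.disjoint_left]
  intro l hl hl'
  simp only [bin, Finset.mem_filter, Finset.mem_univ, true_and] at hl hl'
  have : (i.val + 1) * n / k ≤ j.val * n / k :=
    Nat.div_le_div_right (Nat.mul_le_mul_right n hlt)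
  omega

theorem card_bin (i : Fin k) : (bin n k i).card = (i.val + 1) * n / k - i.val * n / k := by
  have hk : 0 < k := i.pos
  have hle : (i.val + 1) * n / k ≤ n :=
    Nat.div_le_of_le_mul (Nat.mul_le_mul_right n i.isLt)
  rw [← Nat.card_Ico, ← Finset.card_image_of_injective _ Fin.val_injective]
  congr 1
  ext l
  simp only [bin, Finset.mem_image, Finset.mem_filter, Finset.mem_univ, true_and, Finset.mem_Ico]
  constructor
  · rintro ⟨j, hj, rfl⟩
    exact hj
  · intro h
    exact ⟨⟨l, by omega⟩, h, rfl⟩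

theorem card_bin_pos (hkn : k ≤ n) (i : Fin k) : 0 < (bin n k i).card := by
  have hk : 0 < k := i.pos
  have h1 : 1 ≤ n / k := (Nat.one_le_div_iff hk).2 hkn
  have h2 : i.val * n / k + n / k ≤ (i.val + 1) * n / k := by
    rw [add_mul, one_mul]
    exact Nat.div_add_div_le_add_div
  rw [card_bin]
  omega

/-- Each bin has at least ⌊n/k⌋ points, and ⌊n/k⌋ ≥ n/(2k) because n ≥ k. -/
theorem inv_card_bin_le (hkn : k ≤ n) (i : Fin k) :
    ((bin n k i).card : ℝ)⁻¹ ≤ 2 * k / n := by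
  have hk : 0 < k := i.pos
  have hn : 0 < n := hk.trans_le hkn
  have h1 : 1 ≤ n / k := (Nat.one_le_div_iff hk).2 hkn
  have h2 : i.val * n / k + n / k ≤ (i.val + 1) * n / k := by
    rw [add_mul, one_mul]
    exact Nat.div_add_div_le_add_div
  have h3 : n / k ≤ (bin n k i).card := by
    rw [card_bin]
    omega
  have h4 : n ≤ 2 * k * (bin n k i).card := by
    have h5 := Nat.lt_div_mul_add (a := n) hk
    have h6 : k ≤ n / k * k := Nat.le_mul_of_pos_left k h1
    calc n ≤ 2 * (n / k * k) := by omega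
      _ = 2 * k * (n / k) := by ring
      _ ≤ _ := Nat.mul_le_mul_left _ h3
  have h5 : (n : ℝ) ≤ 2 * k * (bin n k i).card := by exact_mod_cast h4
  have h6 : (0 : ℝ) < (bin n k i).card := by exact_mod_cast card_bin_pos hkn i
  have h7 : (0 : ℝ) < n := by exact_mod_cast hn
  rw [inv_eq_one_div, div_le_div_iff₀ h6 h7]
  linarith

end Bins

/-! ### Moments of the bin means -/

section Moments

variable {Ω : Type*} [MeasurableSpace Ω] {P : Measure Ω} [IsProbabilityMeasure P] {n d k : ℕ}
  {X : Fin n → Ω → Vec d} {μ : Vec d} {Sig : Matrix (Fin d) (Fin d) ℝ}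

theorem inner_single_one (a : Fin d) (v : Vec d) :
    inner ℝ (EuclideanSpace.single a (1 : ℝ)) v = v a := by
  rw [EuclideanSpace.inner_single_left]
  simp

theorem variance_inner_eq (hL2 : ∀ i, MemLp (X i) 2 P)
    (hcov : ∀ i a b, covariance (fun ω => X i ω a) (fun ω => X i ω b) P = Sig a b)
    (u : Vec d) (j : Fin n) :
    variance (fun ω => inner ℝ u (X j ω)) P = ∑ a, ∑ b, u a * u b * Sig a b := by
  have hc : ∀ a, MemLp (fun ω => X j ω a) 2 P := fun a => by
    have := (hL2 j).const_inner (𝕜 := ℝ) (EuclideanSpace.single a (1 : ℝ))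
    simpa only [inner_single_one] using this
  have h1 : (fun ω => inner ℝ u (X j ω)) = fun ω => ∑ a, u a * X j ω a := by
    ext ω
    simp [PiLp.inner_apply, mul_comm]
  rw [h1, variance_fun_sum fun a => (hc a).const_mul (u a)]
  refine Finset.sum_congr rfl fun a _ => Finset.sum_congr rfl fun b _ => ?_
  rw [covariance_const_mul_left, covariance_const_mul_right, hcov]
  ring

theorem inner_binMean (x : Fin n → Vec d) (u : Vec d) (i : Fin k) :
    inner ℝ u (binMean k x i) = ((bin n k i).card : ℝ)⁻¹ * ∑ j ∈ bin n k i, inner ℝ u (x j) := by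
  rw [binMean, inner_smul_right, inner_sum]

theorem integral_inner_binMean_sub_sq (hmeas : ∀ i, Measurable (X i)) (hindep : iIndepFun X P)
    (hL2 : ∀ i, MemLp (X i) 2 P) (hmean : ∀ i, ∫ ω, X i ω ∂P = μ)
    (hcov : ∀ i a b, covariance (fun ω => X i ω a) (fun ω => X i ω b) P = Sig a b)
    (hkn : k ≤ n) (u : Vec d) (i : Fin k) :
    ∫ ω, inner ℝ u (binMean k (fun j => X j ω) i - μ) ^ 2 ∂P =
      ((bin n k i).card : ℝ)⁻¹ * ∑ a, ∑ b, u a * u b * Sig a b := by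
  set m := ((bin n k i).card : ℝ) with hm
  have hm0 : m ≠ 0 := by
    rw [hm]
    exact_mod_cast (card_bin_pos hkn i).ne'
  have hfL : ∀ j, MemLp (fun ω => inner ℝ u (X j ω)) 2 P := fun j => (hL2 j).const_inner u
  have hfm : ∀ j, ∫ ω, inner ℝ u (X j ω) ∂P = inner ℝ u μ := fun j => by
    rw [integral_inner ((hL2 j).integrable (by norm_num)), hmean]
  set W : Ω → ℝ := fun ω => ∑ j ∈ bin n k i, inner ℝ u (X j ω) with hW
  have hWsum : W = ∑ j ∈ bin n k i, fun ω => (inner ℝ u (X j ω) : ℝ) := by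
    ext ω
    simp [hW]
  have hvar : variance W P = m * ∑ a, ∑ b, u a * u b * Sig a b := by
    rw [hWsum, IndepFun.variance_sum (fun j _ => hfL j)]
    · rw [Finset.sum_congr rfl fun j _ => variance_inner_eq hL2 hcov u j]
      simp [hm]
    · intro j _ l _ hjl
      have hin : Measurable fun z : Vec d => inner ℝ u z := by fun_prop
      exact (hindep.indepFun hjl).comp hin hin
  have hWm : ∫ ω, W ω ∂P = m * inner ℝ u μ := by
    rw [hW, integral_finsetSum _ fun j _ => (hfL j).integrable (by norm_num)]
    simp [hfm, hm]
  have hWmeas : AEMeasurable W P :=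
    (Finset.measurable_fun_sum _ fun j _ => by have := hmeas j; fun_prop).aemeasurable
  have h1 : ∀ ω, inner ℝ u (binMean k (fun j => X j ω) i - μ) ^ 2 =
      (m⁻¹) ^ 2 * (W ω - ∫ ω, W ω ∂P) ^ 2 := fun ω => by
    rw [inner_sub_right, inner_binMean, hWm, ← mul_pow, mul_sub, inv_mul_cancel_left₀ hm0]
  simp only [h1]
  rw [integral_const_mul, ← variance_eq_integral hWmeas, hvar]
  field_simp

theorem measurable_binMean_sub (hmeas : ∀ i, Measurable (X i)) (i : Fin k) :
    Measurable fun ω => binMean k (fun j => X j ω) i - μ := by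
  unfold binMean
  have : Measurable fun ω => ∑ j ∈ bin n k i, X j ω :=
    Finset.measurable_fun_sum _ fun j _ => hmeas j
  fun_prop

theorem memLp_binMean_sub (hL2 : ∀ i, MemLp (X i) 2 P) (i : Fin k) :
    MemLp (fun ω => binMean k (fun j => X j ω) i - μ) 2 P := by
  have h : MemLp (fun ω => ∑ j ∈ bin n k i, X j ω) 2 P := memLp_finsetSum _ fun j _ => hL2 j
  exact (h.const_smul ((bin n k i).card : ℝ)⁻¹).sub (memLp_const μ)

theorem integral_norm_binMean_sub_sq (hmeas : ∀ i, Measurable (X i)) (hindep : iIndepFun X P)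
    (hL2 : ∀ i, MemLp (X i) 2 P) (hmean : ∀ i, ∫ ω, X i ω ∂P = μ)
    (hcov : ∀ i a b, covariance (fun ω => X i ω a) (fun ω => X i ω b) P = Sig a b)
    (hkn : k ≤ n) (i : Fin k) :
    ∫ ω, ‖binMean k (fun j => X j ω) i - μ‖ ^ 2 ∂P = ((bin n k i).card : ℝ)⁻¹ * Sig.trace := by
  have h1 : ∀ ω, ‖binMean k (fun j => X j ω) i - μ‖ ^ 2 =
      ∑ a, (inner ℝ (EuclideanSpace.single a (1 : ℝ))
        (binMean k (fun j => X j ω) i - μ)) ^ 2 := fun ω => by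
    rw [EuclideanSpace.real_norm_sq_eq]
    simp only [inner_single_one]
  simp only [h1]
  rw [integral_finsetSum _ fun a _ =>
    ((memLp_binMean_sub hL2 i).const_inner (EuclideanSpace.single a (1 : ℝ))).integrable_sq]
  simp only [integral_inner_binMean_sub_sq hmeas hindep hL2 hmean hcov hkn]
  rw [← Finset.mul_sum]
  congr 1
  refine Finset.sum_congr rfl fun a _ => ?_
  simp

theorem iIndepFun_binMean_sub (hmeas : ∀ i, Measurable (X i)) (hindep : iIndepFun X P) :
    iIndepFun (fun (i : Fin k) ω => binMean k (fun j => X j ω) i - μ) P := by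
  have h := iIndepFun_of_disjoint_blocks hindep hmeas (fun i : Fin k => bin n k i) bin_disjoint
    (fun i y => ((bin n k i).card : ℝ)⁻¹ • ∑ j, y j - μ) fun i => by
      have : Measurable fun y : bin n k i → Vec d => ∑ j, y j :=
        Finset.measurable_fun_sum _ fun j _ => measurable_pi_apply j
      fun_prop
  convert h using 3 with i ω
  rw [binMean, Finset.sum_coe_sort (bin n k i) fun j => X j ω]

theorem quadForm_le_specNorm (A : Matrix (Fin d) (Fin d) ℝ) {u : Vec d} (hu : ‖u‖ ≤ 1) :
    ∑ a, ∑ b, u a * u b * A a b ≤ specNorm A := by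
  set T := Matrix.toEuclideanCLM (n := Fin d) (𝕜 := ℝ) A with hT
  have h1 : ∑ a, ∑ b, u a * u b * A a b = inner ℝ u (T u) := by
    rw [PiLp.inner_apply, hT, Matrix.ofLp_toEuclideanCLM]
    refine Finset.sum_congr rfl fun a _ => ?_
    simp only [Matrix.mulVec, dotProduct, RCLike.inner_apply, RCLike.conj_to_real, Finset.sum_mul]
    exact Finset.sum_congr rfl fun b _ => by ring
  rw [h1]
  calc _ ≤ ‖u‖ * ‖T u‖ := real_inner_le_norm _ _
    _ ≤ 1 * (‖T‖ * 1) := by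
        refine mul_le_mul hu ?_ (norm_nonneg _) one_pos.le
        exact (T.le_opNorm u).trans (mul_le_mul_of_nonneg_left hu (norm_nonneg _))
    _ = _ := by rw [one_mul, mul_one]; rfl

end Moments

/-! ### The good event -/

theorem measureReal_clampSup_binMean_le {Ω : Type*} [MeasurableSpace Ω] {P : Measure Ω}
    [IsProbabilityMeasure P] {n d : ℕ} {X : Fin n → Ω → Vec d} {μ : Vec d}
    {Sig : Matrix (Fin d) (Fin d) ℝ} (hmeas : ∀ i, Measurable (X i)) (hindep : iIndepFun X P)
    (hL2 : ∀ i, MemLp (X i) 2 P) (hmean : ∀ i, ∫ ω, X i ω ∂P = μ)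
    (hcov : ∀ i a b, covariance (fun ω => X i ω a) (fun ω => X i ω b) P = Sig a b)
    {δ : ℝ} (hδ0 : 0 < δ) (hδ1 : δ < 1) (hn : numBins δ ≤ n) {ρ : ℝ} (hρ : 0 < ρ)
    (hle : 3750 * (Real.sqrt (Sig.trace / n) +
      Real.sqrt (specNorm Sig * Real.log (1 / δ) / n)) ≤ ρ) :
    P.real {ω | ((numBins δ : ℕ) : ℝ) / 20 <
      clampSup ρ fun i => binMean (numBins δ) (fun j => X j ω) i - μ} ≤ δ := by
  set k := numBins δ with hk
  set L := Real.log (1 / δ) with hL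
  set a := Real.sqrt (Sig.trace / n) with ha
  set b := Real.sqrt (specNorm Sig * L / n) with hb
  have hk0 : 0 < k := numBins_pos hδ0 hδ1
  have hk' : (0 : ℝ) < k := by exact_mod_cast hk0
  have hn' : (0 : ℝ) < n := by exact_mod_cast hk0.trans_le hn
  have hL0 : 0 < L := Real.log_pos (one_lt_one_div hδ0 hδ1)
  have hkL : 3200 * L ≤ k := Nat.le_ceil _
  have hkL' : (k : ℝ) < 3200 * L + 1 := Nat.ceil_lt_add_one (by positivity)
  set Y : Fin k → Ω → Vec d := fun i ω => binMean k (fun j => X j ω) i - μ with hY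
  have hYm : ∀ i, Measurable (Y i) := fun i => measurable_binMean_sub hmeas i
  set ν : Fin k → Measure (Vec d) := fun i => P.map (Y i) with hν
  have hνp : ∀ i, IsProbabilityMeasure (ν i) := fun i =>
    Measure.isProbabilityMeasure_map (hYm i).aemeasurable
  have hmap : P.map (fun ω i => Y i ω) = Measure.pi ν :=
    (iIndepFun_binMean_sub hmeas hindep).map_fun_eq_pi_map fun i => (hYm i).aemeasurable
  have hYsq : ∀ i, ∫ z, ‖z‖ ^ 2 ∂ν i = ((bin n k i).card : ℝ)⁻¹ * Sig.trace := fun i => by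
    rw [hν, integral_map (hYm i).aemeasurable (by fun_prop)]
    exact integral_norm_binMean_sub_sq hmeas hindep hL2 hmean hcov hn i
  have hν2 : ∀ i, Integrable (fun z => ‖z‖ ^ 2) (ν i) := fun i => by
    rw [hν, integrable_map_measure (by fun_prop) (hYm i).aemeasurable]
    exact (memLp_binMean_sub hL2 i).integrable_norm_pow two_ne_zero
  have hcard : ∀ i : Fin k, (0 : ℝ) < ((bin n k i).card : ℝ)⁻¹ := fun i =>
    inv_pos.2 (by exact_mod_cast card_bin_pos hn i)
  have htr : 0 ≤ Sig.trace := by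
    have h : 0 ≤ ∫ z, ‖z‖ ^ 2 ∂ν ⟨0, hk0⟩ := integral_nonneg fun z => by positivity
    rw [hYsq] at h
    exact nonneg_of_mul_nonneg_right h (hcard _)
  have hsp : 0 ≤ specNorm Sig := norm_nonneg _
  have ha2 : a ^ 2 = Sig.trace / n := Real.sq_sqrt (by positivity)
  have hb2 : b ^ 2 = specNorm Sig * L / n := Real.sq_sqrt (by positivity)
  have ha0 : 0 ≤ a := Real.sqrt_nonneg _
  have hb0 : 0 ≤ b := Real.sqrt_nonneg _
  have hσ : ∀ i (u : UnitBall (Vec d)), ∫ z, inner ℝ (u : Vec d) z ^ 2 ∂ν i ≤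
      (80 * b + 3 / 2 * a) ^ 2 := fun i u => by
    have h1 : ∫ z, inner ℝ (u : Vec d) z ^ 2 ∂ν i =
        ((bin n k i).card : ℝ)⁻¹ * ∑ a, ∑ b, (u : Vec d) a * (u : Vec d) b * Sig a b := by
      rw [hν, integral_map (hYm i).aemeasurable (by fun_prop)]
      exact integral_inner_binMean_sub_sq hmeas hindep hL2 hmean hcov hn u i
    have h2 : ∫ z, inner ℝ (u : Vec d) z ^ 2 ∂ν i ≤ ∫ z, ‖z‖ ^ 2 ∂ν i := by
      refine integral_mono_of_nonneg (Filter.Eventually.of_forall fun z => by positivity) (hν2 i)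
        (Filter.Eventually.of_forall fun z => ?_)
      have := pow_le_pow_left₀ (abs_nonneg _) (abs_inner_unitBall_le u z) 2
      rwa [sq_abs] at this
    set q := ∑ a, ∑ b, (u : Vec d) a * (u : Vec d) b * Sig a b with hq
    have hq1 : q ≤ specNorm Sig := quadForm_le_specNorm Sig (mem_closedBall_zero_iff.1 u.2)
    -- Comparing second moments gives this without any spectral information on `Sig`.
    have hq2 : q ≤ Sig.trace := by
      rw [h1, hYsq] at h2
      exact le_of_mul_le_mul_left h2 (hcard i)
    have hq0 : 0 ≤ q := by
      have h : 0 ≤ ∫ z, inner ℝ (u : Vec d) z ^ 2 ∂ν i := integral_nonneg fun z => by positivity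
      rw [h1] at h
      exact nonneg_of_mul_nonneg_right h (hcard i)
    rw [h1]
    calc _ ≤ 2 * k / n * q := mul_le_mul_of_nonneg_right (inv_card_bin_le hn i) hq0
      -- L may be arbitrarily small, so the 1 from rounding up k is charged to the trace; 6400 = 80²
      -- and 2 ≤ (3/2)² give the final square.
      _ ≤ 2 * (3200 * L + 1) / n * q := by gcongr
      _ = 6400 * (q * L / n) + 2 * (q / n) := by ring
      _ ≤ 6400 * (specNorm Sig * L / n) + 2 * (Sig.trace / n) := by gcongr
      _ ≤ _ := by
          rw [← ha2, ← hb2]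
          nlinarith [mul_nonneg ha0 hb0, sq_nonneg a]
  have hsum : Real.sqrt (∑ i, ∫ z, ‖z‖ ^ 2 ∂ν i) ≤ 3 / 2 * (k * a) := by
    refine Real.sqrt_le_iff.2 ⟨by positivity, ?_⟩
    calc ∑ i, ∫ z, ‖z‖ ^ 2 ∂ν i ≤ ∑ _i : Fin k, 2 * k / n * Sig.trace :=
          Finset.sum_le_sum fun i _ => by
            rw [hYsq]
            exact mul_le_mul_of_nonneg_right (inv_card_bin_le hn i) htr
      _ = 2 * k ^ 2 * (Sig.trace / n) := by
          simp only [Finset.sum_const, Finset.card_univ, Fintype.card_fin, nsmul_eq_mul]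
          ring
      _ ≤ _ := by
          rw [← ha2]
          nlinarith [sq_nonneg (k * a)]
  -- The left side is at most k(7.875a + 140b), and (3/80) · 3750 = 140.625.
  have hmain := measureReal_clampSup_gt_le ν hν2 (by positivity : 0 ≤ 80 * b + 3 / 2 * a) hρ hσ (by
    have h1 : (k : ℝ) * (3750 * (a + b)) ≤ k * ρ := mul_le_mul_of_nonneg_left hle hk'.le
    have h2 : 0 ≤ (k : ℝ) * a := by positivity
    have h3 : 0 ≤ (k : ℝ) * b := by positivity
    nlinarith)
  rw [← hmap, map_measureReal_apply (measurable_pi_lambda _ hYm)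
    (measurableSet_lt measurable_const (continuous_clampSup hρ).measurable)] at hmain
  refine hmain.trans ?_
  calc Real.exp (-(k / 3200)) ≤ Real.exp (-L) := Real.exp_le_exp.2 (by linarith)
    _ = δ := by rw [hL, one_div, Real.log_inv, neg_neg, Real.exp_log hδ0]

end SubGaussianMean

end

/-! ### The main theorem. -/

theorem theorem1 {Ω : Type*} [MeasurableSpace Ω] (P : MeasureTheory.Measure Ω)
    [MeasureTheory.IsProbabilityMeasure P]
    (n d : ℕ) (hd : 0 < d)
    (X : Fin n → Ω → EuclideanSpace ℝ (Fin d))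
    (hmeas : ∀ i, Measurable (X i))
    (hindep : ProbabilityTheory.iIndepFun X P)
    (hident : ∀ i j, ProbabilityTheory.IdentDistrib (X i) (X j) P P)
    (hL2 : ∀ i, MeasureTheory.MemLp (X i) 2 P)
    (μ : EuclideanSpace ℝ (Fin d)) (hmean : ∀ i, ∫ ω, X i ω ∂P = μ)
    (Sig : Matrix (Fin d) (Fin d) ℝ)
    (hcov : ∀ i a b,
      ProbabilityTheory.covariance (fun ω => X i ω a) (fun ω => X i ω b) P = Sig a b)
    (δ : ℝ) (hδ0 : 0 < δ) (hδ1 : δ < 1)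
    (hn : SubGaussianMean.numBins δ ≤ n)
    (ε : ℝ) (hε : 0 < ε) :
    (∀ ω, ∃ xstar, SubGaussianMean.MeanEstimation (fun i => X i ω) δ
        ⌈1000 * Real.log (‖μ‖ / ε)⌉₊ (1 / 20) xstar) ∧
    ∃ A : Set Ω, MeasurableSet A ∧ 1 - δ ≤ P.real A ∧
      ∀ ω ∈ A, ∀ xstar, SubGaussianMean.MeanEstimation (fun i => X i ω) δ
        ⌈1000 * Real.log (‖μ‖ / ε)⌉₊ (1 / 20) xstar →
        ‖xstar - μ‖ ≤ max ε (480000 *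
          (Real.sqrt (Sig.trace / (n : ℝ)) +
            Real.sqrt (SubGaussianMean.specNorm Sig * Real.log (1 / δ) / (n : ℝ)))) := by
  have hk := SubGaussianMean.numBins_pos hδ0 hδ1
  refine ⟨fun ω => ?_, ?_⟩
  · obtain ⟨s, hs⟩ := SubGaussianMean.exists_loopReaches hd hk
      (SubGaussianMean.binMean (SubGaussianMean.numBins δ) fun i => X i ω) (1 / 20)
      (⌈1000 * Real.log (‖μ‖ / ε)⌉₊ + 1)
    exact ⟨s.best, s, hs, rfl⟩
  · set s := Real.sqrt (Sig.trace / (n : ℝ)) +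
      Real.sqrt (SubGaussianMean.specNorm Sig * Real.log (1 / δ) / (n : ℝ)) with hs
    -- The final error is max(ε, 128ρ) and 128 · 3750 = 480000. The term ε/128 keeps ρ positive when
    -- s = 0 and adds nothing beyond ε.
    set ρ := max (3750 * s) (ε / 128) with hρdef
    have hρ : 0 < ρ := lt_max_of_lt_right (by positivity)
    have hbad := SubGaussianMean.measureReal_clampSup_binMean_le hmeas hindep hL2 hmean hcov
      hδ0 hδ1 hn hρ (le_max_left _ _)
    set B : Set Ω := {ω | ((SubGaussianMean.numBins δ : ℕ) : ℝ) / 20 <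
      SubGaussianMean.clampSup ρ fun i =>
        SubGaussianMean.binMean (SubGaussianMean.numBins δ) (fun j => X j ω) i - μ} with hB
    have hBm : MeasurableSet B := measurableSet_lt measurable_const
      ((SubGaussianMean.continuous_clampSup hρ).measurable.comp
        (measurable_pi_lambda _ fun i => SubGaussianMean.measurable_binMean_sub hmeas i))
    refine ⟨Bᶜ, hBm.compl, ?_, ?_⟩
    · rw [MeasureTheory.probReal_compl_eq_one_sub hBm]
      linarith
    · rintro ω hω _ ⟨st, hst, rfl⟩
      simp only [hB, Set.mem_compl_iff, Set.mem_ofPred_eq, not_lt] at hω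
      have h := SubGaussianMean.norm_best_sub_le (μ := μ)
        (fun Y hY => (hY.objective_le_clampSup hρ).trans hω) hk hρ hε hst
      refine h.trans (max_le (le_max_left _ _) ?_)
      rw [hρdef, mul_max_of_nonneg _ _ (by norm_num : (0 : ℝ) ≤ 128)]
      refine max_le (le_max_of_le_right (by linarith)) (le_max_of_le_left (by linarith))
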